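/- **Setting.** Fix $T>0$, $\gamma\in(0,1)$, $N=N_\gamma:=\lfloor 1/\gamma\rfloor$ and $d,n\in\mathbb N$. Words are finite sequences $w$ of letters in $\{1,\dots,d\}$, $|w|$ is the length and $\varepsilon$ the empty word. $H_M$ is the tensor algebra over $\mathbb R^d$ truncated at level $M$, with basis $(e_w)_{|w|\le M}$, $e_\varepsilon=\mathbf 1$, and dual basis $(e_w^*)$ of $H_M^*$; $\sqcup\!\sqcup$ is the shuffle product, and $\langle g\star h,e_w\rangle=\sum_{uv=w}\langle g,e_u\rangle\langle h,e_v\rangle$ for $g,h\in H_M^*$. $G^{(N)}$ is the group of $g\in H_N^*$ with $\langle g,\mathbf 1\rangle=1$ and $\langle g,e_u\sqcup\!\sqcup e_v\rangle=\langle g,e_u\rangle\langle g,e_v\rangle$ for $|u|+|v|\le N$, where $\langle g^{-1},e_{i_1\cdots i_p}\rangle=(-1)^p\langle g,e_{i_p\cdots i_1}\rangle$. It carries the metric $d_N(g,h)=\|h^{-1}\star g\|$ of the homogeneous norm $\|g\|=\max_{1\le|w|\le N}(|w|!\,|\langle g,e_w\rangle|)^{1/|w|}$. A (weakly) geometric rough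 path of regularity $\gamma$ is a $\gamma$-Hölder path $\mathbf W:[0,T]\to(G^{(N)},d_N)$; write $\mathbf W_{st}=\mathbf W_s^{-1}\star\mathbf W_t$. Write $a_{st}\underset{\theta}{=}b_{st}$ if there is $C$ with $|a_{st}-b_{st}|\le C|t-s|^\theta$ for all $0\le s<t\le T$. For $1\le K\le N+1$, $\mathscr D^{K\gamma}_{\mathbf W}$ is the set of paths $\mathbf Y:[0,T]\to H_{K-1}$ such that, for every word $|w|\le K-1$, $t\mapsto\langle e_w^*,\mathbf Y_t\rangle$ is $\gamma$-Hölder and $\langle e_w^*,\mathbf Y_t\rangle\underset{(K-|w|)\gamma}{=}\langle\mathbf W_{st}\star e_w^*,\mathbf Y_s\rangle$. For $\mathbf Y\in\mathscr D^{N\gamma}_{\mathbf W}$ the rough integral is $$\int_0^tY_u\,d\mathbf W^i_u=\lim_{|\pi|\to0}\sum_{[a,b]\in\pi}\ \sum_{|w|\le N-1}\langle e_w^*,\mathbf Y_a\rangle\langle\mathbf W_{ab},e_{wi}\rangle,$$ the limit being over partitions $\pi$ of $[0,t]$, and $\int_s^t=\int_0^t-\int_0^s$. It is lifted to $\int_0^t\mathbf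 Y_u\,d\mathbf W^i_u\in H_N$, with coefficient $\int_0^tY_u\,d\mathbf W^i_u$ at $\varepsilon$, $\langle e_w^*,\mathbf Y_t\rangle$ at $wi$, and $0$ at the other words. For a path $\mathbf X$ with values in $(H_M)^n$ put $X=\langle\mathbf 1^*,\mathbf X\rangle$. The lift $\mathbf\Phi(\mathbf X)$ of $\phi(X)$, for $\phi:\mathbb R^n\to\mathbb R$ smooth enough, takes values in $H_M$ and is given by $\langle\mathbf 1^*,\mathbf\Phi(\mathbf X)_t\rangle=\phi(X_t)$ and, for $w\neq\varepsilon$, $$\langle e_w^*,\mathbf\Phi(\mathbf X)_t\rangle=\sum_{k=1}^{|w|}\frac1{k!}\sum_{u_1,\dots,u_k\ne\varepsilon}\langle e_w^*,e_{u_1}\sqcup\!\sqcup\cdots\sqcup\!\sqcup e_{u_k}\rangle\,D^k\phi(X_t)\big(\langle e_{u_1}^*,\mathbf X_t\rangle,\dots,\langle e_{u_k}^*,\mathbf X_t\rangle\big).$$ For vector fields $f_1,\dots,f_d:\mathbb R^n\to\mathbb R^n$ put $\Gamma_i\phi(x)=D\phi(x)f_i(x)$, $F_\varepsilon=\mathrm{id}$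 and $F_{iw}(x)=DF_w(x)f_i(x)$. A path $\mathbf X:[0,T]\to(H_N)^n$ solves the RDE $dX=\sum_if_i(X)\,d\mathbf W^i$, $X_0=x$, if its truncation to $(H_{N-1})^n$ lies in $(\mathscr D^{N\gamma}_{\mathbf W})^n$, $\mathbf X_0=\sum_{|w|\le N}F_w(x)e_w$, and $$\mathbf X_t-\mathbf X_s=\sum_{i=1}^d\int_s^t\mathbf F_i(\mathbf X)_u\,d\mathbf W^i_u\quad\text{in }(H_N)^n\text{ for all }s,t\in[0,T],$$ where $\mathbf F_i(\mathbf X)$ is the (componentwise) lift of $f_i(X)$ with values in $(H_{N-1})^n$. **Theorem (Itô formula for RDEs).** Let $\mathbf W$ be a geometric rough path of regularity $\gamma$, let $f_1,\dots,f_d$ be of class $\mathcal C^{N+1}$, let $\mathbf X$ solve the RDE with $X_0=x\in\mathbb R^n$, and let $\phi\in\mathcal C^{N+1}_b(\mathbb R^n)$ be real valued (bounded with bounded derivatives up to order $N+1$). Let $\Gamma_i\mathbf\Phi(\mathbf X)$ be the lift of $\Gamma_i\phi(X)$ with values in $H_{N-1}$. Then $\mathbf X\in(\mathscr D^{(N+1)\gamma}_{\mathbf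 W})^n$, $\mathbf\Phi(\mathbf X)\in\mathscr D^{(N+1)\gamma}_{\mathbf W}$, $\Gamma_i\mathbf\Phi(\mathbf X)\in\mathscr D^{N\gamma}_{\mathbf W}$, the rough integrals of $\Gamma_i\mathbf\Phi(\mathbf X)$ against $\mathbf W^i$ exist, and $$\phi(X_t)=\phi(X_s)+\sum_{i=1}^d\int_s^t(\Gamma_i\phi)(X_r)\,d\mathbf W^i_r\qquad\text{for all }s,t\in[0,T].$$ More generally, for every non-empty word $w$ with $|w|\le N$, $$\langle e_w^*,\mathbf\Phi(\mathbf X)_t\rangle\underset{(N+1-|w|)\gamma}{=}\langle e_w^*,\mathbf\Phi(\mathbf X)_s\rangle+\Big\langle e_w^*,\sum_{i=1}^d\int_s^t\Gamma_i\mathbf\Phi(\mathbf X)_r\,d\mathbf W^i_r\Big\rangle.$$ -/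

import Mathlib

open Finset

namespace RoughIto

noncomputable section

/-! ### Words, truncated tensors, shuffles -/

/-- Words over the alphabet `{1, …, d}`; the empty word `ε` is `[]`, concatenation is `++`. -/
abbrev Word (d : ℕ) := List (Fin d)

/-- Words of length at most `N`. -/
abbrev TWord (d N : ℕ) := {w : Word d // w.length ≤ N}

instance (d N : ℕ) : Finite (TWord d N) := (List.finite_length_le (Fin d) N).to_subtype

instance (d N : ℕ) : Fintype (TWord d N) := Fintype.ofFinite _

/-- The step-`N` truncated tensor algebra `H_N = ⨁_{p ≤ N} (ℝ^d)^{⊗ p}`, an element being given by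
its coordinates in the basis `(e_w)_{|w| ≤ N}`. The dual space `H_N^*` is written in the same way,
in the dual basis `(e_w^*)_{|w| ≤ N}`. -/
abbrev Tens (d N : ℕ) := TWord d N → ℝ

/-- The coordinate at the word `w`: `⟨e_w^*, x⟩` for `x ∈ H_N`, and `⟨g, e_w⟩` for `g ∈ H_N^*`
(zero for words of length `> N`). -/
def coeff {d N : ℕ} (x : Tens d N) (w : Word d) : ℝ :=
  if h : w.length ≤ N then x ⟨w, h⟩ else 0

/-- Restriction to (or extension by zero to) the words of length at most `M`. -/
def trunc {d N : ℕ} (M : ℕ) (x : Tens d N) : Tens d M := fun w => coeff x w.1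

/-- The duality pairing `⟨g, x⟩` of `g ∈ H_N^*` and `x ∈ H_N`. -/
def pair {d N : ℕ} (g x : Tens d N) : ℝ := ∑ w : TWord d N, g w * x w

/-- The element `e_w^*` of the dual basis. -/
def dualBasis {d : ℕ} (N : ℕ) (w : Word d) : Tens d N := fun v => if v.1 = w then 1 else 0

/-- The convolution product: `⟨g ⋆ h, e_w⟩ = ∑_{uv = w} ⟨g, e_u⟩ ⟨h, e_v⟩`. -/
def conv {d N : ℕ} (g h : Tens d N) : Tens d N := fun w =>
  ∑ k ∈ range (w.1.length + 1), coeff g (w.1.take k) * coeff h (w.1.drop k)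

/-- The inverse `g⁻¹ = g ∘ S` of a character, with the antipode
`S e_{i_1 ⋯ i_p} = (-1)^p e_{i_p ⋯ i_1}`. -/
def inv {d N : ℕ} (g : Tens d N) : Tens d N := fun w =>
  (-1) ^ w.1.length * coeff g w.1.reverse

/-- The words occurring in the shuffle product `e_u ⧢ e_v`, listed with multiplicity. -/
def shuffle {d : ℕ} : Word d → Word d → List (Word d)
  | [], v => [v]
  | a :: u, [] => [a :: u]
  | a :: u, b :: v =>
      (shuffle u (b :: v)).map (fun w => a :: w) ++ (shuffle (a :: u) v).map (fun w => b :: w)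
termination_by u v => u.length + v.length

/-- The words occurring in `e_{u_1} ⧢ ⋯ ⧢ e_{u_k}`, listed with multiplicity. -/
def shuffles {d : ℕ} : List (Word d) → List (Word d)
  | [] => [[]]
  | u :: us => (shuffles us).flatMap (shuffle u)

/-- The multiplicity `⟨e_w^*, e_{u_1} ⧢ ⋯ ⧢ e_{u_k}⟩`. -/
def shuffleCoeff {d k : ℕ} (u : Fin k → Word d) (w : Word d) : ℕ :=
  (shuffles (List.ofFn u)).count w

/-- Step-`N` truncated characters, i.e. the elements of the group `G^{(N)}`:
`⟨g, 1⟩ = 1` and `⟨g, e_u ⧢ e_v⟩ = ⟨g, e_u⟩ ⟨g, e_v⟩` whenever `|u| + |v| ≤ N`. -/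
structure IsTruncChar {d N : ℕ} (g : Tens d N) : Prop where
  unit : coeff g [] = 1
  mul : ∀ u v : Word d, u.length + v.length ≤ N →
    ((shuffle u v).map (coeff g)).sum = coeff g u * coeff g v

/-! ### Geometric rough paths -/

/-- The homogeneous norm `‖g‖ = max_{1 ≤ |w| ≤ N} (|w|! |⟨g, e_w⟩|)^{1/|w|}` on `G^{(N)}`; it is
symmetric and sub-additive (by the binomial theorem). -/
def homNorm {d N : ℕ} (g : Tens d N) : ℝ :=
  ⨆ w : {w : Word d // 1 ≤ w.length ∧ w.length ≤ N},
    ((w.1.length.factorial : ℝ) * |coeff g w.1|) ^ (1 / (w.1.length : ℝ))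

/-- The left-invariant metric `d_N(g, h) = ‖h⁻¹ ⋆ g‖` on `G^{(N)}`. -/
def homDist {d N : ℕ} (g h : Tens d N) : ℝ := homNorm (conv (inv h) g)

/-- `N_γ = ⌊1/γ⌋`. -/
def Nγ (γ : ℝ) : ℕ := ⌊γ⁻¹⌋₊

/-- `W : [0,T] → G^{(N_γ)}` is a (weakly) geometric rough path of regularity `γ`. -/
structure IsGeometricRoughPath {d : ℕ} (γ T : ℝ) (W : ℝ → Tens d (Nγ γ)) : Prop where
  char : ∀ t ∈ Set.Icc 0 T, IsTruncChar (W t)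
  holder : ∃ C : ℝ, ∀ s ∈ Set.Icc 0 T, ∀ t ∈ Set.Icc 0 T,
    homDist (W s) (W t) ≤ C * |t - s| ^ γ

/-- The increment `W_{st} = W_s⁻¹ ⋆ W_t`. -/
def incr {d N : ℕ} (W : ℝ → Tens d N) (s t : ℝ) : Tens d N := conv (inv (W s)) (W t)

/-- `a_{st} = b_{st}` up to order `θ`: `|a_{st} - b_{st}| ≤ C |t - s|^θ` for all `0 ≤ s < t ≤ T`,
with `C` independent of `s, t`. -/
def EqOrder (T θ : ℝ) (a b : ℝ → ℝ → ℝ) : Prop :=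
  ∃ C : ℝ, ∀ s t : ℝ, 0 ≤ s → s < t → t ≤ T → |a s t - b s t| ≤ C * (t - s) ^ θ

/-! ### Controlled rough paths -/

/-- `X : [0,T] → H_M` belongs to `𝒟_W^{(M+1)γ}`: for every word `|w| ≤ M` the path
`t ↦ ⟨e_w^*, X_t⟩` is `γ`-Hölder and `⟨e_w^*, X_t⟩ = ⟨W_{st} ⋆ e_w^*, X_s⟩` up to order
`(M + 1 - |w|) γ`. (Used for `M ≤ N_γ`.) -/
def IsControlled {d M : ℕ} (γ T : ℝ) (W : ℝ → Tens d (Nγ γ)) (X : ℝ → Tens d M) : Prop :=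
  ∀ w : Word d, w.length ≤ M →
    EqOrder T γ (fun _ t => coeff (X t) w) (fun s _ => coeff (X s) w) ∧
    EqOrder T (((M : ℝ) + 1 - w.length) * γ) (fun _ t => coeff (X t) w)
      (fun s t => pair (conv (trunc M (incr W s t)) (dualBasis M w)) (X s))

/-- `p 0 < p 1 < ⋯ < p m` is a partition of `[0,t]` of mesh less than `δ`. -/
structure IsPartition (t δ : ℝ) (m : ℕ) (p : ℕ → ℝ) : Prop where
  left : p 0 = 0
  right : p m = t
  lt : ∀ k < m, p k < p (k + 1)
  mesh : ∀ k < m, p (k + 1) - p k < δ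

/-- The local approximation `∑_{0 ≤ |w| ≤ N_γ - 1} ⟨e_w^*, Y_a⟩ ⟨W_{ab}, e_{wi}⟩` of the rough
integral `∫_a^b Y dW^i`. -/
def germ {d : ℕ} {γ : ℝ} (W : ℝ → Tens d (Nγ γ)) (i : Fin d) (Y : ℝ → Tens d (Nγ γ - 1))
    (a b : ℝ) : ℝ :=
  ∑ w : TWord d (Nγ γ - 1), coeff (Y a) w.1 * coeff (incr W a b) (w.1 ++ [i])

/-- `I t = ∫_0^t Y_u dW^i_u` for all `t ∈ [0,T]`: `I t` is the limit of the compensated Riemann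
sums along the partitions of `[0,t]` as their mesh tends to zero. -/
def IsRoughIntegral {d : ℕ} {γ : ℝ} (T : ℝ) (W : ℝ → Tens d (Nγ γ)) (i : Fin d)
    (Y : ℝ → Tens d (Nγ γ - 1)) (I : ℝ → ℝ) : Prop :=
  ∀ t ∈ Set.Icc 0 T, ∀ ε > 0, ∃ δ > 0, ∀ (m : ℕ) (p : ℕ → ℝ), IsPartition t δ m p →
    |∑ k ∈ range m, germ W i Y (p k) (p (k + 1)) - I t| < ε

/-- The value in `H_M` of the rough integral `∫_0^t Y_u dW^i_u` regarded as a controlled path, where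
`y = Y_t` and `I = ∫_0^t Y_u dW^i_u ∈ ℝ`: the coefficient of the empty word is `I`, the coefficient
of `wi` is `⟨e_w^*, y⟩`, and the other coefficients vanish. -/
def integralLift {d K : ℕ} (M : ℕ) (i : Fin d) (I : ℝ) (y : Tens d K) : Tens d M := fun w =>
  if w.1 = [] then I else if w.1.getLast? = some i then coeff y w.1.dropLast else 0

/-! ### Composition with a smooth function -/

/-- `ℝ^n`. -/
abbrev E (n : ℕ) := EuclideanSpace ℝ (Fin n)

/-- The vector `⟨e_w^*, X⟩ ∈ ℝ^n` for `X ∈ (H_M)^n`. -/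
def vcoeff {d n M : ℕ} (X : Fin n → Tens d M) (w : Word d) : E n :=
  WithLp.toLp 2 (fun j => coeff (X j) w)

/-- Truncation of each component. -/
def vtrunc {d n N : ℕ} (M : ℕ) (X : Fin n → Tens d N) : Fin n → Tens d M :=
  fun j => trunc M (X j)

/-- The lift `Φ(X)` of `φ(X)`: the coefficient of the empty word is `φ(⟨1^*, X⟩)`, and that of a
non-empty word `w` is
`∑_{k=1}^{|w|} 1/k! ∑_{u_1, …, u_k} ⟨e_w^*, e_{u_1} ⧢ ⋯ ⧢ e_{u_k}⟩
  D^kφ(⟨1^*, X⟩)(⟨e_{u_1}^*, X⟩, …, ⟨e_{u_k}^*, X⟩)`, the sum being over non-empty words. -/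
def compLift {d n M : ℕ} (φ : E n → ℝ) (X : Fin n → Tens d M) : Tens d M := fun w =>
  if w.1 = [] then φ (vcoeff X []) else
    ∑ k ∈ Icc 1 w.1.length, (1 / (k.factorial : ℝ)) *
      ∑ u ∈ (univ : Finset (Fin k → TWord d M)) with ∀ r, (u r).1 ≠ [],
        (shuffleCoeff (fun r => (u r).1) w.1 : ℝ) *
          iteratedFDeriv ℝ k φ (vcoeff X []) (fun r => vcoeff X (u r).1)

/-- Bounded with bounded derivatives up to order `k`: the class `C^k_b(ℝ^n)`. -/
def IsCb {n : ℕ} (k : ℕ) (φ : E n → ℝ) : Prop :=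
  ContDiff ℝ k φ ∧ ∃ C : ℝ, ∀ l ≤ k, ∀ x, ‖iteratedFDeriv ℝ l φ x‖ ≤ C

/-! ### Rough differential equations -/

/-- `Γ_i φ = f_i · Dφ`. -/
def Γ {d n : ℕ} (f : Fin d → E n → E n) (i : Fin d) (φ : E n → ℝ) : E n → ℝ :=
  fun x => fderiv ℝ φ x (f i x)

/-- The iterated vector fields: `F_ε = id` and `F_{iw}(x) = DF_w(x) f_i(x)`. -/
def Fw {d n : ℕ} (f : Fin d → E n → E n) : Word d → E n → E n
  | [] => id
  | i :: w => fun x => fderiv ℝ (Fw f w) x (f i x)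

/-- The lift of `f_i^j(X)` to `H_{N_γ - 1}`. -/
def fieldLift {d n : ℕ} {γ : ℝ} (f : Fin d → E n → E n) (X : ℝ → Fin n → Tens d (Nγ γ))
    (i : Fin d) (j : Fin n) : ℝ → Tens d (Nγ γ - 1) :=
  fun t => compLift (fun y => f i y j) (vtrunc (Nγ γ - 1) (X t))

/-- `X : [0,T] → (H_{N_γ})^n` solves `dX = ∑_i f_i(X) dW^i`, `X_0 = x`: its truncation to
`H_{N_γ - 1}` lies in `(𝒟_W^{N_γ γ})^n`, it starts from `∑_w F_w(x) e_w`, and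
`X_t - X_s = ∑_i ∫_s^t F_i(X)_u dW^i_u` for all `s, t ∈ [0,T]`, where the integrals are rough
integrals of the lifts of `f_i(X)`, taken with all their coefficients. -/
structure IsRDESolution {d n : ℕ} {γ : ℝ} (T : ℝ) (W : ℝ → Tens d (Nγ γ))
    (f : Fin d → E n → E n) (x : E n) (X : ℝ → Fin n → Tens d (Nγ γ)) : Prop where
  controlled : ∀ j, IsControlled γ T W (fun t => vtrunc (Nγ γ - 1) (X t) j)
  init : ∀ j (w : TWord d (Nγ γ)), X 0 j w = Fw f w.1 x j
  eqn : ∃ J : Fin d → Fin n → ℝ → ℝ,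
    (∀ i j, IsRoughIntegral T W i (fieldLift f X i j) (J i j)) ∧
    ∀ s ∈ Set.Icc 0 T, ∀ t ∈ Set.Icc 0 T, ∀ j,
      X t j - X s j = ∑ i, (integralLift (Nγ γ) i (J i j t) (fieldLift f X i j t) -
        integralLift (Nγ γ) i (J i j s) (fieldLift f X i j s))

/-- The lift `Γ_iΦ(X)` to `H_{N_γ - 1}` of the composition of `X` with `Γ_i φ`. -/
def gammaLift {d n : ℕ} {γ : ℝ} (f : Fin d → E n → E n) (φ : E n → ℝ)
    (X : ℝ → Fin n → Tens d (Nγ γ)) (i : Fin d) : ℝ → Tens d (Nγ γ - 1) :=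
  fun t => compLift (Γ f i φ) (vtrunc (Nγ γ - 1) (X t))

end

end RoughIto

open RoughIto

/-! The coefficients of a solution carry no information beyond its value: the coefficient at `w` is
`F_w(X_t)` for every `t` (`IsRDESolution.vcoeff_eq`). This propagates from shorter words to `wi` by
comparing the equation in `H_N` at the times `0` and `t`. The algebra behind it is a Faà di Bruno
formula (`lieIter_eq_sum_shuffleSum`): where the coefficients are `F_u(x)`, the lift of `ψ` has the
coefficient `Γ_{i_1} ⋯ Γ_{i_p} ψ(x)` at `w = i_1 ⋯ i_p`; write `Γ_w ψ(x)` for it. Differentiating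
`D^kψ(F_{u_1}, …, F_{u_k})` along `f_i` either adds an argument `F_i = f_i` or puts `i` in front of
some `u_r`; dually, removing a first letter is a derivation of the shuffle product.

Being controlled thus becomes a matter of local expansions `ψ(X_t) = ∑_{|v| ≤ k} ⟨W_{st}, e_v⟩
Γ_vψ(X_s) + O(|t - s|^{(k+1)γ})`. `HasExpansion.comp` passes from the identity to any smooth `ψ`:
the expansion of `X` is inserted into Taylor's formula, the character property linearises the
products of coefficients of `W_{st}`, and Faà di Bruno identifies the result. By definition a
solution is expanded to order `Nγ` only. This already makes the lifts of `f_i(X)` controlled, so by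
the sewing lemma their integrals agree with their germs up to order `(N+1)γ`, and the equation
raises the expansion of `X` to that order.

At order `(N+1)γ` the expansion of `φ(X)` is `φ(X_s)` plus the germs of the integrals of `Γ_iφ(X)`,
because a non-empty word has the form `wi` and `Γ_{wi}φ = Γ_w(Γ_iφ)`. Hence `φ(X) - ∑_i ∫ Γ_iφ(X)
dW^i` has increments of order `(N+1)γ > 1` and is constant. At non-empty words the same identity
makes the required estimate an exact equality. -/

namespace RoughIto

noncomputable section

section

/-! ### Shuffles and convolution of functionals on words -/

variable {d : ℕ}

/-- The value of a functional on words at the shuffle product of two words. -/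
def shuffleEval (g : Word d → ℝ) (u v : Word d) : ℝ := ((shuffle u v).map g).sum

/-- The convolution of two functionals on words. -/
def wconv (g h : Word d → ℝ) (w : Word d) : ℝ :=
  ∑ k ∈ range (w.length + 1), g (w.take k) * h (w.drop k)

theorem shuffle_nil_left (v : Word d) : shuffle [] v = [v] := by
  rw [shuffle]

theorem shuffle_nil_right (u : Word d) : shuffle u [] = [u] := by
  cases u <;> rw [shuffle]

theorem shuffleEval_nil_left (g : Word d → ℝ) (v : Word d) : shuffleEval g [] v = g v := by
  simp [shuffleEval, shuffle_nil_left]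

theorem shuffleEval_nil_right (g : Word d → ℝ) (u : Word d) : shuffleEval g u [] = g u := by
  simp [shuffleEval, shuffle_nil_right]

theorem shuffleEval_cons_cons (g : Word d → ℝ) (a b : Fin d) (u v : Word d) :
    shuffleEval g (a :: u) (b :: v) =
      shuffleEval (fun w => g (a :: w)) u (b :: v) +
        shuffleEval (fun w => g (b :: w)) (a :: u) v := by
  simp [shuffleEval, shuffle, Function.comp_def]

theorem shuffleEval_add (g h : Word d → ℝ) (u v : Word d) :
    shuffleEval (fun w => g w + h w) u v = shuffleEval g u v + shuffleEval h u v := by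
  simp [shuffleEval, List.sum_map_add]

theorem shuffleEval_const_mul (c : ℝ) (h : Word d → ℝ) (u v : Word d) :
    shuffleEval (fun w => c * h w) u v = c * shuffleEval h u v := by
  simp [shuffleEval, List.sum_map_mul_left]

theorem length_of_mem_shuffle {u v w : Word d} (hw : w ∈ shuffle u v) :
    w.length = u.length + v.length := by
  induction u, v using shuffle.induct generalizing w with
  | case1 v => simp_all [shuffle_nil_left]
  | case2 a u => simp_all [shuffle_nil_right]
  | case3 a u b v ih₁ ih₂ =>
    rw [shuffle] at hw
    simp only [List.mem_append, List.mem_map] at hw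
    rcases hw with ⟨w, hw, rfl⟩ | ⟨w, hw, rfl⟩
    · simp only [List.length_cons, ih₁ hw]; omega
    · simp only [List.length_cons, ih₂ hw]; omega

theorem shuffleEval_congr {g h : Word d → ℝ} {u v : Word d}
    (H : ∀ w : Word d, w.length = u.length + v.length → g w = h w) :
    shuffleEval g u v = shuffleEval h u v := by
  unfold shuffleEval
  congr 1
  exact List.map_congr_left fun w hw => H w (length_of_mem_shuffle hw)

theorem wconv_nil (g h : Word d → ℝ) : wconv g h [] = g [] * h [] := by
  simp [wconv]

theorem wconv_cons (g h : Word d → ℝ) (a : Fin d) (w : Word d) :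
    wconv g h (a :: w) = g [] * h (a :: w) + wconv (fun w => g (a :: w)) h w := by
  unfold wconv
  rw [List.length_cons, Finset.sum_range_succ', add_comm]
  simp

theorem wconv_add_left (g₁ g₂ h : Word d → ℝ) (w : Word d) :
    wconv (fun w => g₁ w + g₂ w) h w = wconv g₁ h w + wconv g₂ h w := by
  simp [wconv, add_mul, Finset.sum_add_distrib]

theorem wconv_const_mul_left (c : ℝ) (g h : Word d → ℝ) (w : Word d) :
    wconv (fun w => c * g w) h w = c * wconv g h w := by
  simp [wconv, mul_assoc, Finset.mul_sum]

theorem wconv_assoc (g h k : Word d → ℝ) (w : Word d) :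
    wconv (wconv g h) k w = wconv g (wconv h k) w := by
  induction w generalizing g h with
  | nil => simp [wconv_nil, mul_assoc]
  | cons a w ih =>
    rw [wconv_cons, wconv_cons, wconv_nil]
    have : (fun w => wconv g h (a :: w)) =
        fun w => (g [] * h (a :: w)) + wconv (fun w => g (a :: w)) h w :=
      funext fun w => wconv_cons _ _ _ _
    rw [this, wconv_add_left, wconv_const_mul_left, ih, wconv_cons]
    ring

/-- Deconcatenation is multiplicative for the shuffle product. -/
theorem shuffleEval_wconv (g h : Word d → ℝ) (u v : Word d) :
    shuffleEval (wconv g h) u v =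
      ∑ j ∈ range (u.length + 1), ∑ k ∈ range (v.length + 1),
        shuffleEval g (u.take j) (v.take k) * shuffleEval h (u.drop j) (v.drop k) := by
  induction u, v using shuffle.induct generalizing g with
  | case1 v => simp [shuffleEval_nil_left, wconv]
  | case2 a u => simp [shuffleEval_nil_right, wconv]
  | case3 a u b v ih₁ ih₂ =>
    have e : ∀ c : Fin d, (fun w => wconv g h (c :: w)) =
        fun w => (g [] * h (c :: w)) + wconv (fun w => g (c :: w)) h w :=
      fun c => funext fun w => wconv_cons _ _ _ _
    rw [shuffleEval_cons_cons, e a, e b, shuffleEval_add, shuffleEval_add, shuffleEval_const_mul,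
      shuffleEval_const_mul, ih₁, ih₂]
    simp only [List.length_cons]
    -- The cuts with `j = 0` or `k = 0` are isolated: there a prefix is empty and the first-letter
    -- recursion for `g` degenerates.
    rw [Finset.sum_range_succ' (n := u.length + 1)
      (f := fun j => ∑ k ∈ range (v.length + 1 + 1),
        shuffleEval g ((a :: u).take j) ((b :: v).take k) *
          shuffleEval h ((a :: u).drop j) ((b :: v).drop k)),
      Finset.sum_range_succ' (n := u.length + 1)
      (f := fun j => ∑ k ∈ range (v.length + 1),
        shuffleEval (fun w => g (b :: w)) ((a :: u).take j) (v.take k) *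
          shuffleEval h ((a :: u).drop j) (v.drop k))]
    simp only [Finset.sum_range_succ' (n := v.length + 1), List.take_succ_cons, List.drop_succ_cons,
      List.take_zero, List.drop_zero, shuffleEval_cons_cons, shuffleEval_nil_left,
      shuffleEval_nil_right, add_mul, Finset.sum_add_distrib]
    ring

/-- Shuffles are defined by recursion on first letters. The antipode reverses words, so it calls for
this mirror recursion on last letters. -/
theorem shuffleEval_append_append (g : Word d → ℝ) (u v : Word d) (a b : Fin d) :
    shuffleEval g (u ++ [a]) (v ++ [b]) =
      shuffleEval (fun w => g (w ++ [a])) u (v ++ [b]) +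
        shuffleEval (fun w => g (w ++ [b])) (u ++ [a]) v := by
  induction u, v using shuffle.induct generalizing g with
  | case1 v =>
    induction v generalizing g with
    | nil => simp [shuffleEval_cons_cons, shuffleEval_nil_left, shuffleEval_nil_right, add_comm]
    | cons c v ih =>
      have := ih (fun w => g (c :: w))
      simp only [List.nil_append, List.cons_append, shuffleEval_cons_cons, shuffleEval_nil_left]
        at this ⊢
      rw [this]; ring
  | case2 c u =>
    induction u generalizing g c with
    | nil =>
      simp only [List.nil_append, List.cons_append, shuffleEval_cons_cons, shuffleEval_nil_left,
        shuffleEval_nil_right]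
      ring
    | cons c' u ih =>
      have := ih c' (fun w => g (c :: w))
      simp only [List.nil_append, List.cons_append, shuffleEval_cons_cons (b := b),
        shuffleEval_nil_right] at this ⊢
      linarith
  | case3 c u c' v ih₁ ih₂ =>
    have h₁ := ih₁ (fun w => g (c :: w))
    have h₂ := ih₂ (fun w => g (c' :: w))
    simp only [List.cons_append] at h₁ h₂ ⊢
    rw [shuffleEval_cons_cons, h₁, h₂, shuffleEval_cons_cons, shuffleEval_cons_cons]
    simp only [List.cons_append]
    ring

theorem shuffleEval_reverse (g : Word d → ℝ) (u v : Word d) :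
    shuffleEval (fun w => g w.reverse) u v = shuffleEval g u.reverse v.reverse := by
  induction u, v using shuffle.induct generalizing g with
  | case1 v => simp [shuffleEval_nil_left]
  | case2 a u => simp [shuffleEval_nil_right]
  | case3 a u b v ih₁ ih₂ =>
    rw [List.reverse_cons, List.reverse_cons, shuffleEval_append_append, shuffleEval_cons_cons]
    simp only [List.reverse_cons]
    rw [ih₁ (fun w => g (w ++ [a])), ih₂ (fun w => g (w ++ [b]))]
    simp only [List.reverse_cons]

/-- The antipode identity. -/
theorem sum_shuffleEval_reverse (g : Word d → ℝ) (u v : Word d) :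
    ∑ k ∈ range (v.length + 1),
      (-1 : ℝ) ^ k * shuffleEval g (u ++ v.take k) (v.drop k).reverse =
    if u = [] then (if v = [] then g [] else 0) else
      (shuffleEval (fun w => g (w ++ u.getLast?.toList)) u.dropLast v.reverse) := by
  induction v generalizing u with
  | nil =>
    rcases List.eq_nil_or_concat u with rfl | ⟨u, a, rfl⟩
    · simp [shuffleEval_nil_left]
    · simp [shuffleEval_nil_right]
  | cons b v ih =>
    rw [List.length_cons, Finset.sum_range_succ']
    -- The terms `k ≥ 1` are minus the sum for `u ++ [b]`, that is, minus the shuffles of `u` and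
    -- `v.reverse` followed by `b`. They cancel the words ending in `b` in the term `k = 0`. This
    -- telescoping is why `u` is arbitrary.
    have := ih (u ++ [b])
    simp only [List.append_assoc, List.cons_append, List.nil_append] at this
    simp only [List.take_succ_cons, List.drop_succ_cons, pow_succ, mul_neg, mul_one, neg_mul,
      Finset.sum_neg_distrib, this]
    rcases List.eq_nil_or_concat u with rfl | ⟨u, a, rfl⟩
    · simp [shuffleEval_nil_left]
    · simp [shuffleEval_append_append]

/-! ### The group of truncated characters -/

theorem coeff_of_le {N : ℕ} (x : Tens d N) {w : Word d} (h : w.length ≤ N) :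
    coeff x w = x ⟨w, h⟩ := dif_pos h

theorem coeff_of_lt {N : ℕ} (x : Tens d N) {w : Word d} (h : N < w.length) :
    coeff x w = 0 := dif_neg (by omega)

theorem coeff_trunc {N M : ℕ} (x : Tens d N) {w : Word d} (h : w.length ≤ M) :
    coeff (trunc M x) w = coeff x w := by
  rw [coeff_of_le _ h]; rfl

theorem coeff_conv {N : ℕ} (g h : Tens d N) {w : Word d} (hw : w.length ≤ N) :
    coeff (conv g h) w = wconv (coeff g) (coeff h) w := by
  rw [coeff_of_le _ hw]; rfl

theorem coeff_inv {N : ℕ} (g : Tens d N) (w : Word d) :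
    coeff (inv g) w = (-1) ^ w.length * coeff g w.reverse := by
  by_cases hw : w.length ≤ N
  · rw [coeff_of_le _ hw]; rfl
  · rw [coeff_of_lt _ (by omega), coeff_of_lt _ (by simpa using hw), mul_zero]

theorem wconv_congr {g g' h h' : Word d → ℝ} {w : Word d}
    (hg : ∀ u : Word d, u.length ≤ w.length → g u = g' u)
    (hh : ∀ u : Word d, u.length ≤ w.length → h u = h' u) : wconv g h w = wconv g' h' w := by
  refine Finset.sum_congr rfl fun k hk => ?_
  rw [hg _ (by simp), hh _ (by simp)]

theorem wconv_counit_left (h : Word d → ℝ) (w : Word d) :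
    wconv (fun u => if u = [] then 1 else 0) h w = h w := by
  cases w with
  | nil => simp [wconv_nil]
  | cons a w => simp [wconv]

namespace IsTruncChar

variable {N : ℕ} {g h : Tens d N}

theorem shuffleEval_eq (hg : IsTruncChar g) {u v : Word d} (huv : u.length + v.length ≤ N) :
    shuffleEval (coeff g) u v = coeff g u * coeff g v := hg.mul u v huv

theorem conv (hg : IsTruncChar g) (hh : IsTruncChar h) : IsTruncChar (conv g h) where
  unit := by rw [coeff_conv _ _ (by simp), wconv_nil, hg.unit, hh.unit, mul_one]
  mul u v huv := by
    change shuffleEval _ u v = _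
    rw [shuffleEval_congr (h := wconv (coeff g) (coeff h)) fun w hw =>
      coeff_conv g h (by omega), shuffleEval_wconv, coeff_conv _ _ (by omega),
      coeff_conv _ _ (by omega), wconv, wconv, Finset.sum_mul_sum]
    refine Finset.sum_congr rfl fun j hj => Finset.sum_congr rfl fun k hk => ?_
    rw [hg.shuffleEval_eq (by simp only [List.length_take]; omega),
      hh.shuffleEval_eq (by simp only [List.length_drop]; omega)]
    ring

theorem inv (hg : IsTruncChar g) : IsTruncChar (inv g) where
  unit := by simp [coeff_inv, hg.unit]
  mul u v huv := by
    change shuffleEval _ u v = _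
    rw [shuffleEval_congr (h := fun w => (-1) ^ (u.length + v.length) * coeff g w.reverse)
      fun w hw => by rw [coeff_inv, hw], shuffleEval_const_mul, shuffleEval_reverse,
      hg.shuffleEval_eq (by simpa using huv), coeff_inv, coeff_inv]
    ring

/-- On a character each shuffle in the antipode identity with `u = []` factors, and the alternating
sum becomes `g ⋆ g⁻¹` up to a sign. -/
theorem wconv_inv (hg : IsTruncChar g) {w : Word d} (hw : w.length ≤ N) :
    wconv (coeff g) (coeff (RoughIto.inv g)) w = if w = [] then 1 else 0 := by
  have key := sum_shuffleEval_reverse (coeff g) [] w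
  simp only [List.nil_append, if_true, hg.unit] at key
  have : wconv (coeff g) (coeff (RoughIto.inv g)) w = (-1) ^ w.length *
      ∑ k ∈ range (w.length + 1), (-1 : ℝ) ^ k *
        shuffleEval (coeff g) (w.take k) (w.drop k).reverse := by
    rw [wconv, Finset.mul_sum]
    refine Finset.sum_congr rfl fun k hk => ?_
    have hk' : k ≤ w.length := by simpa [Nat.lt_succ_iff] using hk
    rw [coeff_inv, hg.shuffleEval_eq (by simp; omega), List.length_drop]
    have : (-1 : ℝ) ^ w.length * (-1) ^ k = (-1) ^ (w.length - k) := by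
      obtain ⟨m, hm⟩ := Nat.exists_eq_add_of_le hk'
      rw [hm, Nat.add_sub_cancel_left, pow_add, mul_right_comm, ← mul_pow]; simp
    rw [← this]; ring
  rw [this, key]
  split_ifs with h <;> simp [h]

end IsTruncChar

theorem coeff_incr {N : ℕ} (W : ℝ → Tens d N) (s t : ℝ) {w : Word d} (hw : w.length ≤ N) :
    coeff (incr W s t) w = wconv (coeff (inv (W s))) (coeff (W t)) w := coeff_conv _ _ hw

/-- Chen's relation. -/
theorem chen {N : ℕ} {W : ℝ → Tens d N} {s u t : ℝ} (hu : IsTruncChar (W u)) {w : Word d}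
    (hw : w.length ≤ N) :
    coeff (incr W s t) w = wconv (coeff (incr W s u)) (coeff (incr W u t)) w := by
  -- The product is rebracketed on untruncated functionals, where `wconv` is associative; `W_u ⋆
  -- W_u⁻¹` in the middle is then the counit at the lengths that matter.
  rw [wconv_congr (g' := wconv (coeff (inv (W s))) (coeff (W u)))
    (h' := wconv (coeff (inv (W u))) (coeff (W t)))
    (fun v hv => coeff_incr W s u (hv.trans hw)) (fun v hv => coeff_incr W u t (hv.trans hw)),
    wconv_assoc, coeff_incr W s t hw]
  refine wconv_congr (fun _ _ => rfl) fun v hv => ?_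
  rw [← wconv_assoc, wconv_congr (g' := fun u => if u = [] then 1 else 0) (h' := coeff (W t))
    (fun v' hv' => hu.wconv_inv (by omega)) (fun _ _ => rfl), wconv_counit_left]

end

section

/-! ### Iterated shuffles -/

variable {d : ℕ}

/-- The value of a functional on words at the shuffle product of a tuple of words. -/
def shufflesEval {k : ℕ} (g : Word d → ℝ) (u : Fin k → Word d) : ℝ :=
  ((shuffles (List.ofFn u)).map g).sum

/-- The functional `e_w^*`. -/
def wordDelta (w : Word d) : Word d → ℝ := fun v => if v = w then 1 else 0

/-- The functional `v ↦ ⟨F, ∂_i e_v⟩`, where `∂_i` removes a first letter `i`. -/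
def headDeriv (i : Fin d) (F : Word d → ℝ) : Word d → ℝ :=
  fun v => if v.head? = some i then F v.tail else 0

theorem headDeriv_wordDelta (i : Fin d) (w : Word d) :
    headDeriv i (wordDelta w) = wordDelta (i :: w) := by
  funext v
  cases v with
  | nil => simp [headDeriv, wordDelta]
  | cons a v => by_cases h : a = i <;> simp [headDeriv, wordDelta, h]

theorem shuffleCoeff_eq {k : ℕ} (u : Fin k → Word d) (w : Word d) :
    (shuffleCoeff u w : ℝ) = shufflesEval (wordDelta w) u := by
  unfold shuffleCoeff shufflesEval
  induction shuffles (List.ofFn u) with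
  | nil => simp
  | cons a l ih => by_cases h : a = w <;> simp [ih, wordDelta, h, add_comm]

theorem shufflesEval_zero (g : Word d → ℝ) (u : Fin 0 → Word d) : shufflesEval g u = g [] := by
  simp [shufflesEval, shuffles]

theorem shufflesEval_cons {k : ℕ} (g : Word d → ℝ) (a : Word d) (u : Fin k → Word d) :
    shufflesEval g (Fin.cons a u : Fin (k + 1) → Word d) =
      shufflesEval (fun v => shuffleEval g a v) u := by
  unfold shufflesEval
  rw [List.ofFn_cons, shuffles]
  induction shuffles (List.ofFn u) with
  | nil => simp
  | cons b l ih => simp [ih, shuffleEval]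

theorem shufflesEval_add {k : ℕ} (g h : Word d → ℝ) (u : Fin k → Word d) :
    shufflesEval (fun w => g w + h w) u = shufflesEval g u + shufflesEval h u := by
  simp [shufflesEval, List.sum_map_add]

theorem shufflesEval_const_mul {k : ℕ} (c : ℝ) (h : Word d → ℝ) (u : Fin k → Word d) :
    shufflesEval (fun w => c * h w) u = c * shufflesEval h u := by
  simp [shufflesEval, List.sum_map_mul_left]

theorem shufflesEval_sum {k : ℕ} {ι : Type*} (s : Finset ι) (h : ι → Word d → ℝ)
    (u : Fin k → Word d) :
    shufflesEval (fun w => ∑ j ∈ s, h j w) u = ∑ j ∈ s, shufflesEval (h j) u := by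
  classical
  induction s using Finset.induction_on with
  | empty => simp [shufflesEval]
  | insert a s ha ih => simp only [Finset.sum_insert ha, shufflesEval_add, ih]

theorem shufflesEval_congr {k : ℕ} {g h : Word d → ℝ} {u : Fin k → Word d}
    (H : ∀ w : Word d, w.length = ∑ r, (u r).length → g w = h w) :
    shufflesEval g u = shufflesEval h u := by
  induction k generalizing g h with
  | zero => rw [shufflesEval_zero, shufflesEval_zero, H [] (by simp)]
  | succ k ih =>
    rw [← Fin.cons_self_tail u, shufflesEval_cons, shufflesEval_cons]
    refine ih fun v hv => shuffleEval_congr fun w hw => H w ?_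
    rw [hw, hv, Fin.sum_univ_succ]; rfl

theorem shufflesEval_eq_zero {k : ℕ} {g : Word d → ℝ} {u : Fin k → Word d}
    (H : ∀ w : Word d, w.length = ∑ r, (u r).length → g w = 0) : shufflesEval g u = 0 := by
  rw [shufflesEval_congr (h := fun _ => 0) H]; simp [shufflesEval]

theorem shufflesEval_insertNth_nil {k : ℕ} (g : Word d → ℝ) (r : Fin (k + 1))
    (u : Fin k → Word d) :
    shufflesEval g (r.insertNth [] u : Fin (k + 1) → Word d) = shufflesEval g u := by
  induction k generalizing g with
  | zero =>
    obtain rfl : r = 0 := by omega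
    simp [shufflesEval_cons, shufflesEval_zero, shuffleEval_nil_left]
  | succ k ih =>
    cases r using Fin.cases with
    | zero => simp [shufflesEval_cons, shuffleEval_nil_left]
    | succ r =>
      obtain ⟨a, u, rfl⟩ : ∃ a v, u = Fin.cons a v := ⟨_, _, (Fin.cons_self_tail u).symm⟩
      rw [Fin.insertNth_succ_cons, shufflesEval_cons, ih, ← shufflesEval_cons]

/-- The first letter of a shuffled word comes from one of the two factors, whence a product rule. -/
theorem shuffleEval_headDeriv (i : Fin d) (F : Word d → ℝ) (a v : Word d) :
    shuffleEval (headDeriv i F) a v =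
      (if a.head? = some i then shuffleEval F a.tail v else 0) +
        headDeriv i (shuffleEval F a) v := by
  cases a with
  | nil =>
    have : shuffleEval F [] = F := funext fun v => shuffleEval_nil_left F v
    simp [shuffleEval_nil_left, this]
  | cons a u =>
    cases v with
    | nil => simp [shuffleEval_nil_right, headDeriv]
    | cons b v =>
      have : ∀ c u v, shuffleEval (fun w => headDeriv i F (c :: w)) u v =
          if c = i then shuffleEval F u v else 0 := by
        intro c u v
        by_cases h : c = i <;> simp [headDeriv, h, shuffleEval]
      rw [shuffleEval_cons_cons, this, this]
      simp [headDeriv]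

/-- Removal of a first letter is a derivation of the shuffle product. -/
theorem shufflesEval_headDeriv {k : ℕ} (i : Fin d) (F : Word d → ℝ) (u : Fin k → Word d) :
    shufflesEval (headDeriv i F) u = ∑ r,
      if (u r).head? = some i then shufflesEval F (Function.update u r (u r).tail) else 0 := by
  induction k generalizing F with
  | zero => simp [shufflesEval_zero, headDeriv]
  | succ k ih =>
    obtain ⟨a, u, rfl⟩ : ∃ a v, u = Fin.cons a v := ⟨_, _, (Fin.cons_self_tail u).symm⟩
    rw [shufflesEval_cons]
    simp_rw [shuffleEval_headDeriv i F a]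
    rw [shufflesEval_add, ih, Fin.sum_univ_succ]
    congr 1
    · by_cases h : a.head? = some i
      · simp [h, shufflesEval_cons]
      · simp [h, shufflesEval]
    · refine Finset.sum_congr rfl fun r _ => ?_
      simp only [Fin.cons_succ, ← Fin.cons_update, shufflesEval_cons]

theorem IsTruncChar.shufflesEval_eq {N k : ℕ} {g : Tens d N} (hg : IsTruncChar g)
    {u : Fin k → Word d} (hu : ∑ r, (u r).length ≤ N) :
    shufflesEval (coeff g) u = ∏ r, coeff g (u r) := by
  induction k with
  | zero => simp [shufflesEval_zero, hg.unit]
  | succ k ih =>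
    obtain ⟨a, u, rfl⟩ : ∃ a v, u = Fin.cons a v := ⟨_, _, (Fin.cons_self_tail u).symm⟩
    simp only [Fin.sum_univ_succ, Fin.cons_zero, Fin.cons_succ] at hu
    rw [shufflesEval_cons, shufflesEval_congr (h := fun v => coeff g a * coeff g v)
      fun w hw => hg.shuffleEval_eq (by omega), shufflesEval_const_mul, ih (by omega),
      Fin.prod_univ_succ]
    simp

/-! ### Sums over words of bounded length -/

/-- The words of length at most `M`. -/
def words (d M : ℕ) : Finset (Word d) := (List.finite_length_le (Fin d) M).toFinset

@[simp] theorem mem_words {M : ℕ} {w : Word d} : w ∈ words d M ↔ w.length ≤ M := by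
  simp [words]

theorem sum_tword {M : ℕ} (g : Word d → ℝ) : ∑ w : TWord d M, g w.1 = ∑ w ∈ words d M, g w :=
  (Finset.sum_subtype (words d M) (fun _ => mem_words) g).symm

theorem shufflesEval_eq_sum {k M : ℕ} (g : Word d → ℝ) {u : Fin k → Word d}
    (hu : ∑ r, (u r).length ≤ M) :
    shufflesEval g u = ∑ w ∈ words d M, g w * shufflesEval (wordDelta w) u := by
  simp_rw [← shufflesEval_const_mul]
  rw [← shufflesEval_sum]
  refine shufflesEval_congr fun v hv => ?_
  simp [wordDelta, hv, hu]

theorem sum_piFinset_insertNth {k : ℕ} {α : Type*} [DecidableEq α] (S : Finset α)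
    (r : Fin (k + 1)) (B : (Fin (k + 1) → α) → ℝ) :
    ∑ u ∈ Fintype.piFinset (fun _ : Fin (k + 1) => S), B u =
      ∑ u ∈ Fintype.piFinset (fun _ : Fin k => S), ∑ a ∈ S, B (r.insertNth a u) := by
  rw [Finset.sum_comm, ← Finset.sum_product']
  refine (Finset.sum_equiv (Fin.insertNthEquiv (fun _ => α) r) (fun p => ?_) fun p _ => rfl).symm
  simp [Fin.forall_iff_succAbove r]

/-- Reindexing by `a ↦ i :: a`. The vanishing of `h` from length `M` on disposes of the words for
which `i :: a` is too long. The empty `a` is kept apart because it will drop out of the shuffles. -/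
theorem sum_words_head {M : ℕ} (i : Fin d) (h H : Word d → ℝ)
    (hh : ∀ a : Word d, M ≤ a.length → h a = 0) :
    ∑ a ∈ (words d M).erase [], (if a.head? = some i then h a.tail else 0) * H a =
      h [] * H [i] + ∑ a ∈ (words d M).erase [], h a * H (i :: a) := by
  rw [Finset.add_sum_erase (words d M) (fun a => h a * H (i :: a)) (by simp)]
  symm
  refine Finset.sum_bij_ne_zero (fun a _ _ => i :: a) (fun a ha h0 => ?_) (fun a _ _ b _ _ h => ?_)
    (fun a ha h0 => ?_) fun a _ _ => by simp
  · have : ¬ M ≤ a.length := fun hM => h0 (by rw [hh a hM, zero_mul])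
    simp; omega
  · simpa using h
  · cases a with
    | nil => simp at h0
    | cons b a =>
      obtain rfl : b = i := by by_contra hb; simp [hb] at h0
      refine ⟨a, ?_, by simpa using h0, rfl⟩
      simp at ha ⊢; omega

/-- `1/k! ∑ ⟨F, e_{u_1} ⧢ ⋯ ⧢ e_{u_k}⟩ G(u_1, …, u_k)`, the sum being over the non-empty words of
length at most `M`. -/
def shuffleSum (M k : ℕ) (F : Word d → ℝ) (G : (Fin k → Word d) → ℝ) : ℝ :=
  (1 / (k.factorial : ℝ)) *
    ∑ u ∈ Fintype.piFinset (fun _ : Fin k => (words d M).erase []), shufflesEval F u * G u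

/-- By the derivation property the letter `i` is removed from one `u_r`. If `u_r = [i]`, only `k`
words remain; by the symmetry of `G` the `k + 1` positions contribute equally, which turns
`1/(k+1)!` into `1/k!`. Otherwise `u_r = i :: a` with `a` non-empty, which is the second sum. -/
theorem shuffleSum_headDeriv {M k : ℕ} (i : Fin d) (F : Word d → ℝ) (G : (Fin (k + 1) → Word d) → ℝ)
    (hF : ∀ v : Word d, M ≤ v.length → F v = 0)
    (hG : ∀ (r : Fin (k + 1)) (a : Word d) (u : Fin k → Word d),
      G (r.insertNth a u) = G (Fin.cons a u)) :
    shuffleSum M (k + 1) (headDeriv i F) G =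
      shuffleSum M k F (fun u => G (Fin.cons [i] u)) +
        ∑ r, shuffleSum M (k + 1) F (fun u => G (Function.update u r (i :: u r))) := by
  have key : ∀ r : Fin (k + 1),
      ∑ u ∈ Fintype.piFinset (fun _ : Fin (k + 1) => (words d M).erase []),
        (if (u r).head? = some i then shufflesEval F (Function.update u r (u r).tail) else 0) * G u =
      ∑ u ∈ Fintype.piFinset (fun _ : Fin k => (words d M).erase []),
        shufflesEval F u * G (Fin.cons [i] u) +
      ∑ u ∈ Fintype.piFinset (fun _ : Fin (k + 1) => (words d M).erase []),
        shufflesEval F u * G (Function.update u r (i :: u r)) := by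
    intro r
    rw [sum_piFinset_insertNth _ r, sum_piFinset_insertNth _ r, ← Finset.sum_add_distrib]
    refine Finset.sum_congr rfl fun u _ => ?_
    simp only [Fin.insertNth_apply_same, Fin.update_insertNth]
    rw [sum_words_head i (fun a => shufflesEval F (r.insertNth a u : Fin (k + 1) → Word d))
      (fun a => G (r.insertNth a u)) fun a ha => shufflesEval_eq_zero fun v hv => hF v ?_]
    · simp only [shufflesEval_insertNth_nil, hG]
    · rw [hv, Fin.sum_univ_succAbove _ r]; simp; omega
  unfold shuffleSum
  simp_rw [shufflesEval_headDeriv, Finset.sum_mul]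
  rw [Finset.sum_comm, Finset.sum_congr rfl fun r _ => key r, Finset.sum_add_distrib,
    ← Finset.mul_sum, mul_add]
  congr 1
  have : ((k + 1).factorial : ℝ) = (k + 1) * k.factorial := by push_cast [Nat.factorial_succ]; ring
  have h1 : (k.factorial : ℝ) ≠ 0 := by positivity
  have h2 : (k + 1 : ℝ) ≠ 0 := by positivity
  rw [this]
  simp
  field_simp

/-- Shuffling `k` non-empty words yields words of length at least `k`. -/
theorem shuffleSum_wordDelta_eq_zero {M k : ℕ} {w : Word d} (hk : w.length < k)
    (G : (Fin k → Word d) → ℝ) : shuffleSum M k (wordDelta w) G = 0 := by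
  unfold shuffleSum
  rw [Finset.sum_eq_zero, mul_zero]
  intro u hu
  rw [shufflesEval_eq_zero, zero_mul]
  intro v hv
  have : ∑ _r : Fin k, 1 ≤ ∑ r, (u r).length := Finset.sum_le_sum fun r _ => by
    have := Fintype.mem_piFinset.1 hu r
    simp at this
    exact List.length_pos_iff.2 this.1
  simp at this
  refine if_neg ?_
  rintro rfl
  omega

theorem shuffleSum_zero {M : ℕ} (F : Word d → ℝ) (G : (Fin 0 → Word d) → ℝ) :
    shuffleSum M 0 F G = F [] * G Fin.elim0 := by
  simp only [shuffleSum, shufflesEval_zero]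
  rw [Finset.sum_eq_single Fin.elim0] <;> simp
  all_goals exact fun hb => (hb (Subsingleton.elim _ _)).elim

end

section

/-! ### Symmetry of iterated derivatives -/

section Symmetry

variable {V G : Type*} [NormedAddCommGroup V] [NormedSpace ℝ V]
  [NormedAddCommGroup G] [NormedSpace ℝ G]

theorem iteratedFDeriv_cons {ψ : V → G} {k : ℕ} (hψ : ContDiff ℝ (k + 1 : ℕ) ψ)
    (x a : V) (v : Fin k → V) :
    iteratedFDeriv ℝ (k + 1) ψ x (Fin.cons a v) =
      fderiv ℝ (fun y => iteratedFDeriv ℝ k ψ y v) x a := by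
  have h : DifferentiableAt ℝ (iteratedFDeriv ℝ k ψ) x :=
    hψ.differentiable_iteratedFDeriv (by exact_mod_cast Nat.lt_succ_self k) x
  rw [h.iteratedFDeriv_succ_apply_left']
  simp

theorem iteratedFDeriv_cons_cons_comm {ψ : V → G} {k : ℕ} (hψ : ContDiff ℝ (k + 2 : ℕ) ψ)
    (x a b : V) (v : Fin k → V) :
    iteratedFDeriv ℝ (k + 2) ψ x (Fin.cons a (Fin.cons b v)) =
      iteratedFDeriv ℝ (k + 2) ψ x (Fin.cons b (Fin.cons a v)) := by
  have h1 : ContDiff ℝ (k + 1 : ℕ) ψ := hψ.of_le (by exact_mod_cast Nat.le_succ _)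
  have hg : ContDiff ℝ 2 (fun y => iteratedFDeriv ℝ k ψ y v) :=
    (ContinuousMultilinearMap.apply ℝ (fun _ : Fin k => V) G v).contDiff.comp
      (hψ.iteratedFDeriv_right (m := 2) (by push_cast; rw [add_comm]))
  have hd : DifferentiableAt ℝ (fderiv ℝ (fun y => iteratedFDeriv ℝ k ψ y v)) x :=
    ((hg.fderiv_right (m := 1) (by norm_num)).differentiable (by norm_num)) x
  have key : ∀ a b : V, iteratedFDeriv ℝ (k + 2) ψ x (Fin.cons a (Fin.cons b v)) =
      fderiv ℝ (fderiv ℝ (fun y => iteratedFDeriv ℝ k ψ y v)) x a b := by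
    intro a b
    rw [iteratedFDeriv_cons hψ]
    simp_rw [iteratedFDeriv_cons h1]
    rw [fderiv_clm_apply hd (differentiableAt_const b)]
    simp
  rw [key, key]
  exact hg.contDiffAt.isSymmSndFDerivAt (by simp) a b

/-- Differentiating the symmetry of order `k` moves `a` up to the second slot; the swap of the first
two slots is the symmetry of second derivatives. -/
theorem iteratedFDeriv_insertNth {ψ : V → G} {k : ℕ} (hψ : ContDiff ℝ (k + 1 : ℕ) ψ)
    (x a : V) (r : Fin (k + 1)) (v : Fin k → V) :
    iteratedFDeriv ℝ (k + 1) ψ x (r.insertNth a v : Fin (k + 1) → V) =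
      iteratedFDeriv ℝ (k + 1) ψ x (Fin.cons a v) := by
  induction k generalizing x with
  | zero =>
    obtain rfl : r = 0 := by omega
    simp
  | succ k ih =>
    cases r using Fin.cases with
    | zero => simp
    | succ r =>
      obtain ⟨b, v, rfl⟩ : ∃ b w, v = Fin.cons b w := ⟨_, _, (Fin.cons_self_tail v).symm⟩
      have h1 : ContDiff ℝ (k + 1 : ℕ) ψ := hψ.of_le (by exact_mod_cast Nat.le_succ _)
      rw [Fin.insertNth_succ_cons, iteratedFDeriv_cons hψ]
      simp_rw [ih h1]
      rw [← iteratedFDeriv_cons hψ, iteratedFDeriv_cons_cons_comm hψ]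

end Symmetry

/-! ### Iterated Lie derivatives -/

variable {d n : ℕ} {G : Type*} [NormedAddCommGroup G] [NormedSpace ℝ G]

/-- The iterated derivative `Γ_{i_1} ⋯ Γ_{i_p} ψ` along the vector fields `f`. -/
def lieIter (f : Fin d → E n → E n) (ψ : E n → G) : Word d → E n → G
  | [] => ψ
  | i :: w => fun x => fderiv ℝ (lieIter f ψ w) x (f i x)

theorem lieIter_append (f : Fin d → E n → E n) (ψ : E n → G) (u v : Word d) :
    lieIter f ψ (u ++ v) = lieIter f (lieIter f ψ v) u := by
  induction u with
  | nil => rfl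
  | cons i u ih => simp [lieIter, ih]

theorem lieIter_append_singleton (f : Fin d → E n → E n) (ψ : E n → ℝ) (w : Word d) (i : Fin d) :
    lieIter f ψ (w ++ [i]) = lieIter f (Γ f i ψ) w := lieIter_append f ψ w [i]

theorem Fw_eq_lieIter (f : Fin d → E n → E n) (w : Word d) : Fw f w = lieIter f id w := by
  induction w with
  | nil => rfl
  | cons i w ih => simp [lieIter, Fw, ih]

/-- The bound is `R + 1` because a field is differentiated only by the letters to its left: `p`
letters cost `ψ` `p` derivatives, but the fields at most `p - 1`. -/
theorem contDiff_lieIter {R r : ℕ} {f : Fin d → E n → E n} (hf : ∀ i, ContDiff ℝ R (f i))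
    {ψ : E n → G} {w : Word d} (hψ : ContDiff ℝ (r + w.length : ℕ) ψ) (hr : r + w.length ≤ R + 1) :
    ContDiff ℝ r (lieIter f ψ w) := by
  induction w generalizing r with
  | nil => simpa [lieIter] using hψ
  | cons i w ih =>
    simp only [List.length_cons] at hψ hr
    have := ih (r := r + 1) (hψ.of_le (by exact_mod_cast (by omega))) (by omega)
    exact (this.fderiv_right (by push_cast; rfl)).clm_apply
      ((hf i).of_le (by exact_mod_cast (by omega)))

theorem contDiff_Fw {R r : ℕ} {f : Fin d → E n → E n} (hf : ∀ i, ContDiff ℝ R (f i))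
    {w : Word d} (hr : r + w.length ≤ R + 1) : ContDiff ℝ r (Fw f w) := by
  rw [Fw_eq_lieIter]
  exact contDiff_lieIter hf contDiff_id hr

theorem lieIter_clm_comp {G' : Type*} [NormedAddCommGroup G'] [NormedSpace ℝ G']
    {f : Fin d → E n → E n} (L : G →L[ℝ] G') {ψ : E n → G} {w : Word d}
    (h : ∀ v : Word d, v.length < w.length → Differentiable ℝ (lieIter f ψ v)) :
    lieIter f (fun x => L (ψ x)) w = fun x => L (lieIter f ψ w x) := by
  induction w with
  | nil => rfl
  | cons i w ih =>
    funext x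
    simp only [lieIter]
    rw [ih fun v hv => h v (by simp; omega)]
    have := (L.hasFDerivAt.comp x ((h w (by simp)) x).hasFDerivAt).fderiv
    simp only [Function.comp_def] at this
    rw [this]
    rfl

theorem lieIter_coord {R : ℕ} {f : Fin d → E n → E n} (hf : ∀ i, ContDiff ℝ R (f i))
    {w : Word d} (hw : w.length ≤ R + 1) (j : Fin n) (x : E n) :
    lieIter f (fun y : E n => y j) w x = Fw f w x j := by
  rw [Fw_eq_lieIter]
  refine congrFun (lieIter_clm_comp (EuclideanSpace.proj j : E n →L[ℝ] ℝ) (ψ := id)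
    fun v hv => ?_) x
  exact (contDiff_lieIter (r := 1) hf contDiff_id (by omega)).differentiable (by simp)

/-- `Fw` grows by letters on the left, whereas integration appends its letter on the right; this
reconciles the two. -/
theorem Fw_append_singleton {R : ℕ} {f : Fin d → E n → E n} (hf : ∀ i, ContDiff ℝ R (f i))
    {w : Word d} (hw : w.length ≤ R) (i : Fin d) (j : Fin n) (x : E n) :
    Fw f (w ++ [i]) x j = lieIter f (fun y => f i y j) w x := by
  rw [← lieIter_coord hf (by simpa using hw), lieIter_append_singleton]
  congr 1
  funext y
  exact lieIter_coord hf (w := [i]) (by simp) j y |>.trans (by simp [Fw])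

/-! ### The Faà di Bruno formula on words -/

theorem shuffleSum_add {M k : ℕ} (F : Word d → ℝ) (A B : (Fin k → Word d) → ℝ) :
    shuffleSum M k F (fun u => A u + B u) = shuffleSum M k F A + shuffleSum M k F B := by
  simp [shuffleSum, mul_add, Finset.sum_add_distrib]

theorem shuffleSum_sum {M k : ℕ} {ι : Type*} (s : Finset ι) (F : Word d → ℝ)
    (A : ι → (Fin k → Word d) → ℝ) :
    shuffleSum M k F (fun u => ∑ r ∈ s, A r u) = ∑ r ∈ s, shuffleSum M k F (A r) := by
  simp only [shuffleSum, Finset.mul_sum]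
  rw [Finset.sum_comm]

theorem shuffleSum_congr {M k : ℕ} {F : Word d → ℝ} {A B : (Fin k → Word d) → ℝ}
    (h : ∀ u : Fin k → Word d, (∀ r, (u r).length ≤ M) → A u = B u) :
    shuffleSum M k F A = shuffleSum M k F B := by
  unfold shuffleSum
  congr 1
  refine Finset.sum_congr rfl fun u hu => ?_
  rw [h u fun r => ?_]
  have := Fintype.mem_piFinset.1 hu r
  simp at this
  exact this.2

theorem hasFDerivAt_iteratedFDeriv_Fw {f : Fin d → E n → E n} {ψ : E n → ℝ} {k : ℕ}
    (hψ : ContDiff ℝ (k + 1 : ℕ) ψ) {u : Fin k → Word d}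
    (hF : ∀ r, Differentiable ℝ (Fw f (u r))) (x : E n) :
    ∃ L : E n →L[ℝ] ℝ,
      HasFDerivAt (fun x => iteratedFDeriv ℝ k ψ x (fun r => Fw f (u r) x)) L x ∧
      ∀ i, L (f i x) =
        iteratedFDeriv ℝ (k + 1) ψ x
          (fun r => Fw f ((Fin.cons [i] u : Fin (k + 1) → Word d) r) x) +
        ∑ r, iteratedFDeriv ℝ k ψ x (fun r' => Fw f (Function.update u r (i :: u r) r') x) := by
  have h : DifferentiableAt ℝ (iteratedFDeriv ℝ k ψ) x :=
    hψ.differentiable_iteratedFDeriv (by exact_mod_cast Nat.lt_succ_self k) x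
  refine ⟨_, h.hasFDerivAt.continuousMultilinearMap_apply fun r => (hF r x).hasFDerivAt,
    fun i => ?_⟩
  simp only [_root_.add_apply, _root_.sum_apply,
    ContinuousLinearMap.comp_apply, ContinuousMultilinearMap.apply_apply,
    ContinuousMultilinearMap.toContinuousLinearMap_apply]
  congr 1
  · rw [iteratedFDeriv_succ_apply_left]
    congr 1
    simp [Fw]
  · refine Finset.sum_congr rfl fun r _ => congrArg _ (funext fun r' => ?_)
    by_cases hr : r' = r
    · subst hr; simp [Fw]
    · simp [hr]

theorem lieIter_eq_sum_shuffleSum {M : ℕ} {f : Fin d → E n → E n}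
    (hF : ∀ u : Word d, u.length ≤ M → Differentiable ℝ (Fw f u)) {ψ : E n → ℝ} {w : Word d}
    (hw : w.length ≤ M) (hψ : ContDiff ℝ w.length ψ) (x : E n) :
    lieIter f ψ w x = ∑ k ∈ range (w.length + 1), shuffleSum M k (wordDelta w)
      (fun u => iteratedFDeriv ℝ k ψ x (fun r => Fw f (u r) x)) := by
  induction w generalizing x with
  | nil => simp [lieIter, shuffleSum_zero, wordDelta]
  | cons i w ih =>
    simp only [List.length_cons] at hw hψ
    set T : (k : ℕ) → (Fin k → Word d) → E n → ℝ :=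
      fun k u x => iteratedFDeriv ℝ k ψ x (fun r => Fw f (u r) x) with hT
    have hfun : lieIter f ψ w = fun x => ∑ k ∈ range (w.length + 1),
        shuffleSum M k (wordDelta w) (fun u => T k u x) :=
      funext fun x => ih (by omega) (hψ.of_le (by exact_mod_cast Nat.le_succ _)) x
    have hd : ∀ k ∈ range (w.length + 1), ∀ u : Fin k → Word d, (∀ r, (u r).length ≤ M) →
        ∃ L : E n →L[ℝ] ℝ, HasFDerivAt (T k u) L x ∧ ∀ i, L (f i x) =
          T (k + 1) (Fin.cons [i] u) x + ∑ r, T k (Function.update u r (i :: u r)) x := by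
      intro k hk u hu
      refine hasFDerivAt_iteratedFDeriv_Fw (hψ.of_le ?_) (fun r => hF _ (hu r)) x
      have := Finset.mem_range.1 hk
      exact_mod_cast (by omega)
    choose! L hL hLf using hd
    have hu : ∀ k, ∀ u ∈ Fintype.piFinset (fun _ : Fin k => (words d M).erase []),
        ∀ r, (u r).length ≤ M := fun k u hu r => by
      have := Fintype.mem_piFinset.1 hu r
      simp at this
      exact this.2
    have hder : HasFDerivAt (lieIter f ψ w) (∑ k ∈ range (w.length + 1),
        (1 / (k.factorial : ℝ)) • ∑ u ∈ Fintype.piFinset (fun _ : Fin k => (words d M).erase []),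
          shufflesEval (wordDelta w) u • L k u) x := by
      rw [hfun]
      refine HasFDerivAt.fun_sum fun k hk => HasFDerivAt.const_mul
        (HasFDerivAt.fun_sum fun u hu' => HasFDerivAt.const_mul (hL k hk u (hu k u hu')) _) _
    have h1 : lieIter f ψ (i :: w) x = ∑ k ∈ range (w.length + 1),
        shuffleSum M k (wordDelta w) (fun u => T (k + 1) (Fin.cons [i] u) x +
          ∑ r, T k (Function.update u r (i :: u r)) x) := by
      simp only [lieIter]
      rw [hder.fderiv]
      simp only [_root_.sum_apply, _root_.smul_apply, smul_eq_mul]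
      refine Finset.sum_congr rfl fun k hk => ?_
      unfold shuffleSum
      congr 1
      exact Finset.sum_congr rfl fun u hu' => by rw [hLf k hk u (hu k u hu') i]
    have h2 : ∀ k ∈ range (w.length + 1), shuffleSum M (k + 1) (wordDelta (i :: w))
        (fun u => T (k + 1) u x) = shuffleSum M k (wordDelta w) (fun u => T (k + 1) (Fin.cons [i] u) x)
          + ∑ r, shuffleSum M (k + 1) (wordDelta w)
            (fun u => T (k + 1) (Function.update u r (i :: u r)) x) := by
      intro k hk
      rw [← headDeriv_wordDelta]
      refine shuffleSum_headDeriv i _ _ (fun v hv => if_neg ?_) fun r a u => ?_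
      · rintro rfl; omega
      · have := Finset.mem_range.1 hk
        have hs := iteratedFDeriv_insertNth (k := k) (hψ.of_le (by exact_mod_cast (by omega)))
          x (Fw f a x) r (fun r => Fw f (u r) x)
        have e1 : (fun r' => Fw f ((r.insertNth a u : Fin (k + 1) → Word d) r') x) =
            r.insertNth (Fw f a x) (fun r => Fw f (u r) x) := by
          funext r'
          refine Fin.succAboveCases r ?_ (fun j => ?_) r' <;> simp
        have e2 : (fun r' => Fw f ((Fin.cons a u : Fin (k + 1) → Word d) r') x) =
            Fin.cons (Fw f a x) (fun r => Fw f (u r) x) := by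
          funext r'
          cases r' using Fin.cases <;> simp
        simp only [hT, e1, e2, hs]
    change _ = ∑ k ∈ range (w.length + 1 + 1),
      shuffleSum M k (wordDelta (i :: w)) (fun u => T k u x)
    rw [h1, Finset.sum_range_succ' (n := w.length + 1), Finset.sum_congr rfl h2, shuffleSum_zero,
      Finset.sum_add_distrib]
    simp_rw [shuffleSum_add, shuffleSum_sum]
    rw [Finset.sum_add_distrib, add_assoc]
    congr 1
    -- The two sides differ by a shift of `k` in these sums. The shift is harmless: the term `k =
    -- |w| + 1` vanishes for lack of letters, and the term `k = 0` is an empty sum over `r`.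
    have e1 := Finset.sum_range_succ (fun k => ∑ r, shuffleSum M k (wordDelta w)
      fun u => T k (Function.update u r (i :: u r)) x) (w.length + 1)
    have e2 := Finset.sum_range_succ' (fun k => ∑ r, shuffleSum M k (wordDelta w)
      fun u => T k (Function.update u r (i :: u r)) x) (w.length + 1)
    have e3 : ∑ r, shuffleSum M (w.length + 1) (wordDelta w)
        (fun u => T (w.length + 1) (Function.update u r (i :: u r)) x) = 0 :=
      Finset.sum_eq_zero fun r _ => shuffleSum_wordDelta_eq_zero (Nat.lt_succ_self _) _
    have e4 : wordDelta (i :: w) [] = 0 := if_neg (by simp)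
    rw [e3] at e1
    rw [e4, zero_mul, add_zero, ← add_zero (∑ k ∈ range (w.length + 1), _), ← e1, e2]
    simp

/-- Words longer than `w` cannot contribute, so the cutoff `K` may be as small as `|w|`. The
coefficient at `w` then involves only words of length at most `|w|`, as the induction in
`IsRDESolution.vcoeff_eq` requires. -/
theorem coeff_compLift_eq_sum {M K : ℕ} (φ : E n → ℝ) (X : Fin n → Tens d M) {w : Word d}
    (hw : w.length ≤ K) (hK : K ≤ M) :
    coeff (compLift φ X) w = ∑ k ∈ range (w.length + 1), shuffleSum K k (wordDelta w)
      (fun u => iteratedFDeriv ℝ k φ (vcoeff X []) (fun r => vcoeff X (u r))) := by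
  rw [coeff_of_le _ (hw.trans hK), compLift]
  by_cases h : w = []
  · simp [h, shuffleSum_zero, wordDelta]
  rw [if_neg h, Finset.range_eq_Ico, Finset.sum_eq_sum_Ico_succ_bot (by omega), shuffleSum_zero]
  simp only [wordDelta, if_neg (Ne.symm h), zero_mul, zero_add]
  refine Finset.sum_congr (by ext; simp) fun k _ => ?_
  unfold shuffleSum
  congr 1
  refine Finset.sum_bij_ne_zero (fun u _ _ r => (u r).1) (fun u hu h0 => ?_)
    (fun u _ _ v _ _ h => ?_) (fun u hu h0 => ?_) fun u _ _ => ?_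
  · refine Fintype.mem_piFinset.2 fun r => ?_
    simp only [mem_filter, mem_univ, true_and] at hu
    simp only [mem_erase, ne_eq, hu r, not_false_eq_true, mem_words, true_and]
    by_contra hr
    refine h0 ?_
    rw [shuffleCoeff_eq, shufflesEval_eq_zero, zero_mul]
    intro v hv
    refine if_neg ?_
    rintro rfl
    have := Finset.single_le_sum (f := fun r => (u r).1.length) (fun _ _ => Nat.zero_le _)
      (Finset.mem_univ r)
    omega
  · funext r
    exact Subtype.ext (congrFun h r)
  · have hu' : ∀ r, u r ≠ [] ∧ (u r).length ≤ K := fun r => by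
      simpa using Fintype.mem_piFinset.1 hu r
    refine ⟨fun r => ⟨u r, (hu' r).2.trans hK⟩, ?_, ?_, rfl⟩
    · simp [fun r => (hu' r).1]
    · rw [shuffleCoeff_eq]; exact h0
  · rw [shuffleCoeff_eq]

/-- The coefficients of the lift of `ψ` at the point with coefficients `F_u(x)`. -/
theorem coeff_compLift {R M : ℕ} {f : Fin d → E n → E n} (hf : ∀ i, ContDiff ℝ R (f i))
    {ψ : E n → ℝ} {w : Word d} (hwM : w.length ≤ M) (hwR : w.length ≤ R)
    (hψ : ContDiff ℝ w.length ψ) {X : Fin n → Tens d M} {x : E n}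
    (hX : ∀ u : Word d, u.length ≤ w.length → vcoeff X u = Fw f u x) :
    coeff (compLift ψ X) w = lieIter f ψ w x := by
  rw [coeff_compLift_eq_sum ψ X le_rfl hwM, lieIter_eq_sum_shuffleSum (M := w.length)
    (fun u hu => (contDiff_Fw (r := 1) hf (by omega)).differentiable (by simp)) le_rfl hψ]
  refine Finset.sum_congr rfl fun k _ => shuffleSum_congr fun u hu => ?_
  rw [hX [] (by simp)]
  congr 1
  exact funext fun r => hX _ (hu r)

end

section

open Asymptotics Filter

/-! ### Bounds of a given order on the simplex -/

/-- The filter of the pairs `0 ≤ s < t ≤ T`. -/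
def simplexFilter (T : ℝ) : Filter (ℝ × ℝ) := 𝓟 {p | 0 ≤ p.1 ∧ p.1 < p.2 ∧ p.2 ≤ T}

/-- The gauge `(t - s)^θ`. -/
def simplexGauge (θ : ℝ) (p : ℝ × ℝ) : ℝ := (p.2 - p.1) ^ θ

theorem eventually_simplexFilter {T : ℝ} {P : ℝ × ℝ → Prop} :
    (∀ᶠ p in simplexFilter T, P p) ↔ ∀ p : ℝ × ℝ, 0 ≤ p.1 → p.1 < p.2 → p.2 ≤ T → P p := by
  simp [simplexFilter, eventually_principal]

theorem isBigO_gauge_iff {T θ : ℝ} {V : Type*} [NormedAddCommGroup V] {a : ℝ × ℝ → V} :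
    a =O[simplexFilter T] simplexGauge θ ↔
      ∃ C : ℝ, ∀ s t : ℝ, 0 ≤ s → s < t → t ≤ T → ‖a (s, t)‖ ≤ C * (t - s) ^ θ := by
  rw [simplexFilter, isBigO_principal]
  refine exists_congr fun C => ⟨fun h s t hs hst ht => ?_, fun h p hp => ?_⟩
  · have := h (s, t) ⟨hs, hst, ht⟩
    rwa [simplexGauge, Real.norm_of_nonneg (Real.rpow_nonneg (by simpa using hst.le) _)] at this
  · rw [simplexGauge, Real.norm_of_nonneg (Real.rpow_nonneg (by simpa using hp.2.1.le) _)]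
    exact h p.1 p.2 hp.1 hp.2.1 hp.2.2

/-- Over a principal filter `IsBigO` means one constant on the whole simplex, so its calculus
applies to `EqOrder`. -/
theorem eqOrder_iff {T θ : ℝ} {a b : ℝ → ℝ → ℝ} : EqOrder T θ a b ↔
    (fun p : ℝ × ℝ => a p.1 p.2 - b p.1 p.2) =O[simplexFilter T] simplexGauge θ := by
  rw [isBigO_gauge_iff]; rfl

theorem gauge_isBigO_gauge {T θ θ' : ℝ} (h : θ' ≤ θ) : simplexGauge θ =O[simplexFilter T] simplexGauge θ' := by
  rw [isBigO_gauge_iff]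
  refine ⟨T ^ (θ - θ'), fun s t hs hst ht => ?_⟩
  have h0 : 0 < t - s := sub_pos.2 hst
  rw [simplexGauge, Real.norm_of_nonneg (Real.rpow_nonneg h0.le _)]
  change (t - s) ^ θ ≤ _
  calc (t - s) ^ θ = (t - s) ^ (θ - θ') * (t - s) ^ θ' := by rw [← Real.rpow_add h0]; simp
    _ ≤ _ := by
      gcongr
      linarith

theorem one_eq_gauge : (fun _ => 1 : ℝ × ℝ → ℝ) = simplexGauge 0 := by
  funext p; simp [simplexGauge]

theorem isBigO_one_of_continuous {T B : ℝ} {V G : Type*} [NormedAddCommGroup V] [ProperSpace V]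
    [NormedAddCommGroup G] {X : ℝ → V} (hX : ∀ t ∈ Set.Icc 0 T, ‖X t‖ ≤ B) {g : V → G}
    (hg : Continuous g) : (fun p : ℝ × ℝ => g (X p.1)) =O[simplexFilter T] (fun _ => (1 : ℝ)) := by
  obtain ⟨C, hC⟩ := ((isCompact_closedBall (0 : V) B).image hg).isBounded.exists_norm_le
  rw [one_eq_gauge, isBigO_gauge_iff]
  refine ⟨C, fun s t hs hst ht => ?_⟩
  simp only [Real.rpow_zero, mul_one]
  exact hC _ ⟨X s, by simpa using hX s ⟨hs, by linarith⟩, rfl⟩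

/-! ### Increments of rough paths -/

variable {d : ℕ}

theorem abs_coeff_le_of_homNorm {N : ℕ} {g : Tens d N} {c : ℝ} (hc : homNorm g ≤ c) {w : Word d}
    (h1 : 1 ≤ w.length) (hN : w.length ≤ N) : |coeff g w| ≤ c ^ w.length := by
  have : Finite {w : Word d // 1 ≤ w.length ∧ w.length ≤ N} :=
    ((List.finite_length_le (Fin d) N).subset fun w hw => hw.2).to_subtype
  have h := (le_ciSup (f := fun w : {w : Word d // 1 ≤ w.length ∧ w.length ≤ N} =>
    ((w.1.length.factorial : ℝ) * |coeff g w.1|) ^ (1 / (w.1.length : ℝ)))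
    (Set.finite_range _).bddAbove ⟨w, h1, hN⟩).trans hc
  simp only at h
  have hpos : 0 ≤ (w.length.factorial : ℝ) * |coeff g w| := by positivity
  have h' := pow_le_pow_left₀ (Real.rpow_nonneg hpos _) h w.length
  rw [← Real.rpow_natCast, ← Real.rpow_mul hpos, one_div_mul_cancel (by positivity),
    Real.rpow_one] at h'
  refine le_trans (le_mul_of_one_le_left (abs_nonneg _) ?_) h'
  exact_mod_cast w.length.factorial_pos

variable {γ T : ℝ} {W : ℝ → Tens d (Nγ γ)}

namespace IsGeometricRoughPath

theorem isTruncChar_incr (hW : IsGeometricRoughPath γ T W) {s t : ℝ} (hs : s ∈ Set.Icc 0 T)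
    (ht : t ∈ Set.Icc 0 T) : IsTruncChar (incr W s t) := (hW.char s hs).inv.conv (hW.char t ht)

theorem exists_bound (hW : IsGeometricRoughPath γ T W) : ∃ C : ℝ, 0 ≤ C ∧
    ∀ s ∈ Set.Icc 0 T, ∀ t ∈ Set.Icc 0 T, ∀ w : Word d, w.length ≤ Nγ γ →
      |coeff (incr W s t) w| ≤ C * |t - s| ^ (w.length * γ) := by
  obtain ⟨C, hC⟩ := hW.holder
  refine ⟨∑ k ∈ range (Nγ γ + 1), |C| ^ k, by positivity, fun s hs t ht w hw => ?_⟩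
  have hle : |C| ^ w.length ≤ ∑ k ∈ range (Nγ γ + 1), |C| ^ k :=
    Finset.single_le_sum (f := fun k => |C| ^ k) (fun _ _ => by positivity)
      (Finset.mem_range.2 (by omega))
  refine le_trans ?_ (mul_le_mul_of_nonneg_right hle (by positivity))
  rcases Nat.eq_zero_or_pos w.length with h0 | h0
  · rw [List.length_eq_zero_iff] at h0
    subst h0
    simp [(hW.isTruncChar_incr hs ht).unit]
  -- The times are swapped because `homDist (W t) (W s)` is the norm of `incr W s t`.
  · have h := hC t ht s hs
    rw [abs_sub_comm] at h
    have h' : homNorm (incr W s t) ≤ |C| * |t - s| ^ γ :=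
      h.trans (mul_le_mul_of_nonneg_right (le_abs_self C) (by positivity))
    refine (abs_coeff_le_of_homNorm h' h0 hw).trans (le_of_eq ?_)
    rw [mul_pow, ← Real.rpow_natCast (|t - s| ^ γ), ← Real.rpow_mul (abs_nonneg _), mul_comm γ]

theorem isBigO_incr (hW : IsGeometricRoughPath γ T W) {w : Word d} (hw : w.length ≤ Nγ γ) :
    (fun p : ℝ × ℝ => coeff (incr W p.1 p.2) w) =O[simplexFilter T] simplexGauge (w.length * γ) := by
  obtain ⟨C, -, hC⟩ := hW.exists_bound
  rw [isBigO_gauge_iff]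
  refine ⟨C, fun s t hs hst ht => ?_⟩
  have := hC s ⟨hs, by linarith⟩ t ⟨by linarith, ht⟩ w hw
  rwa [abs_of_pos (sub_pos.2 hst)] at this

end IsGeometricRoughPath

theorem isBigO_prod_gauge {k : ℕ} {ℓ : Fin k → ℝ} {g : Fin k → ℝ × ℝ → ℝ}
    (hg : ∀ r, g r =O[simplexFilter T] simplexGauge (ℓ r)) :
    (fun p => ∏ r, g r p) =O[simplexFilter T] simplexGauge (∑ r, ℓ r) := by
  refine (IsBigO.finsetProd (s := univ) fun r _ => hg r).trans_eventuallyEq ?_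
  refine eventually_simplexFilter.2 fun p _ h _ => ?_
  simp only [simplexGauge]
  rw [Real.rpow_sum_of_pos (sub_pos.2 h)]

/-! ### Taylor's formula -/

theorem exists_taylor_bound {V : Type*} [NormedAddCommGroup V] [NormedSpace ℝ V] [ProperSpace V]
    {ψ : V → ℝ} {k : ℕ} (hψ : ContDiff ℝ (k + 1 : ℕ) ψ) (B : ℝ) :
    ∃ C : ℝ, ∀ x y : V, ‖x‖ ≤ B → ‖x + y‖ ≤ B →
      |ψ (x + y) - ∑ l ∈ range (k + 1), (1 / (l.factorial : ℝ)) * iteratedFDeriv ℝ l ψ x fun _ => y|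
        ≤ C * ‖y‖ ^ (k + 1) := by
  obtain ⟨C, hC⟩ := ((isCompact_closedBall (0 : V) B).image
    (hψ.continuous_iteratedFDeriv (m := k + 1) le_rfl)).isBounded.exists_norm_le
  refine ⟨(k.factorial : ℝ)⁻¹ * C, fun x y hx hxy => ?_⟩
  have ht := map_add_eq_sum_add_integral_iteratedFDeriv (f := ψ) (x := x) (y := y) (n := k)
    fun t _ => by exact_mod_cast hψ.contDiffAt
  rw [ht]
  simp only [one_div, smul_eq_mul, add_sub_cancel_left, abs_mul]
  rw [abs_of_nonneg (by positivity : (0 : ℝ) ≤ (k.factorial : ℝ)⁻¹), mul_assoc]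
  refine mul_le_mul_of_nonneg_left ?_ (by positivity)
  rw [← Real.norm_eq_abs]
  refine (intervalIntegral.norm_integral_le_of_norm_le_const (C := C * ‖y‖ ^ (k + 1))
    fun t ht => ?_).trans (by simp)
  rw [Set.uIoc_of_le zero_le_one] at ht
  -- By convexity the segment stays in the ball, where compactness bounds the derivative of order `k
  -- + 1`.
  have hmem : x + t • y ∈ Metric.closedBall (0 : V) B := by
    have := (convex_closedBall (0 : V) B).add_smul_sub_mem (x := x) (y := x + y) (by simpa using hx)
      (by simpa using hxy) ⟨ht.1.le, ht.2⟩
    simpa using this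
  have h1 : ‖iteratedFDeriv ℝ (k + 1) ψ (x + t • y) fun _ => y‖ ≤ C * ‖y‖ ^ (k + 1) := by
    refine (ContinuousMultilinearMap.le_opNorm _ _).trans ?_
    rw [Finset.prod_const, Finset.card_univ, Fintype.card_fin]
    exact mul_le_mul_of_nonneg_right (hC _ ⟨_, hmem, rfl⟩) (by positivity)
  rw [norm_mul]
  have h2 : ‖(1 - t) ^ k‖ ≤ 1 := by
    rw [norm_pow, Real.norm_eq_abs, abs_of_nonneg (by linarith [ht.2])]
    exact pow_le_one₀ (by linarith [ht.2]) (by linarith [ht.1])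
  exact (mul_le_of_le_one_left (norm_nonneg _) h2).trans h1

end

section

open Asymptotics Filter

/-! ### Expansion of functions of a path with a given local expansion -/

variable {d n : ℕ} {γ T : ℝ} {W : ℝ → Tens d (Nγ γ)}

/-- The local expansion of order `(K + 1) γ` of `ψ(X)`. -/
def HasExpansion {G : Type*} [NormedAddCommGroup G] [NormedSpace ℝ G] (T : ℝ)
    (W : ℝ → Tens d (Nγ γ)) (f : Fin d → E n → E n) (X : ℝ → E n) (K : ℕ) (ψ : E n → G) : Prop :=
  (fun p : ℝ × ℝ => ψ (X p.2) -
    ∑ v ∈ words d K, coeff (incr W p.1 p.2) v • lieIter f ψ v (X p.1))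
      =O[simplexFilter T] simplexGauge ((K + 1) * γ)

theorem words_zero : words d 0 = {[]} := by
  ext w; simp

theorem words_mono {k K : ℕ} (h : k ≤ K) : words d k ⊆ words d K := fun w hw => by
  simp only [mem_words] at *; omega

theorem incr_nil_eventually (hW : IsGeometricRoughPath γ T W) :
    ∀ᶠ p in simplexFilter T, coeff (incr W p.1 p.2) [] = 1 :=
  eventually_simplexFilter.2 fun p h1 h2 h3 =>
    (hW.isTruncChar_incr ⟨h1, by linarith⟩ ⟨by linarith, h3⟩).unit

variable {f : Fin d → E n → E n} {X : ℝ → E n} {B : ℝ}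

theorem isBigO_incr_smul {G : Type*} [NormedAddCommGroup G] [NormedSpace ℝ G]
    (hW : IsGeometricRoughPath γ T W) {v : Word d} (hv : v.length ≤ Nγ γ) {θ : ℝ}
    (hθ : θ ≤ v.length * γ) {g : ℝ × ℝ → G} (hg : g =O[simplexFilter T] (fun _ => (1 : ℝ))) :
    (fun p : ℝ × ℝ => coeff (incr W p.1 p.2) v • g p) =O[simplexFilter T] simplexGauge θ := by
  simpa using ((hW.isBigO_incr hv).trans (gauge_isBigO_gauge hθ)).smul hg

/-- Products of coefficients of the increments, expanded with the shuffle product. -/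
theorem isBigO_prod_incr_sub (hγ : 0 < γ) (hW : IsGeometricRoughPath γ T W) {k l : ℕ}
    (hk : k ≤ Nγ γ) {u : Fin l → Word d} (hu : ∀ r, (u r).length ≤ Nγ γ) :
    (fun p : ℝ × ℝ => ∏ r, coeff (incr W p.1 p.2) (u r) -
      ∑ v ∈ words d k, coeff (incr W p.1 p.2) v * shufflesEval (wordDelta v) u)
        =O[simplexFilter T] simplexGauge ((k + 1) * γ) := by
  rcases le_or_gt (∑ r, (u r).length) k with h | h
  -- Short words: the character property makes the difference zero.
  · refine (EventuallyEq.trans_isBigO ?_ (isBigO_zero (E' := ℝ) _ _))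
    refine eventually_simplexFilter.2 fun p h1 h2 h3 => ?_
    have hc := hW.isTruncChar_incr (s := p.1) (t := p.2) ⟨h1, by linarith⟩ ⟨by linarith, h3⟩
    simp only
    rw [← hc.shufflesEval_eq (h.trans hk), shufflesEval_eq_sum _ h, sub_self]
  -- Long words: no shuffle has length at most `k`, and the product alone is small enough.
  · have h0 : ∀ v ∈ words d k, shufflesEval (wordDelta v) u = 0 := fun v hv =>
      shufflesEval_eq_zero fun w hw => if_neg fun hwv => by
        subst hwv; rw [mem_words] at hv; omega
    have : ∀ p : ℝ × ℝ,
        ∑ v ∈ words d k, coeff (incr W p.1 p.2) v * shufflesEval (wordDelta v) u = 0 :=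
      fun p => Finset.sum_eq_zero fun v hv => by rw [h0 v hv, mul_zero]
    simp only [this, sub_zero]
    refine (isBigO_prod_gauge fun r => hW.isBigO_incr (hu r)).trans (gauge_isBigO_gauge ?_)
    rw [← Finset.sum_mul]
    have : ((k + 1 : ℕ) : ℝ) ≤ ((∑ r, (u r).length : ℕ) : ℝ) := by exact_mod_cast h
    push_cast at this
    gcongr

theorem isBigO_multilinear_sub {V : Type*} [NormedAddCommGroup V] [NormedSpace ℝ V] {l : ℕ}
    {F : Filter (ℝ × ℝ)} {D : ℝ × ℝ → ContinuousMultilinearMap ℝ (fun _ : Fin l => V) ℝ}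
    {y z : ℝ × ℝ → V} (hD : D =O[F] (fun _ => (1 : ℝ))) (hy : y =O[F] (fun _ => (1 : ℝ)))
    (hz : z =O[F] (fun _ => (1 : ℝ))) :
    (fun p => D p (fun _ => y p) - D p (fun _ => z p)) =O[F] fun p => y p - z p := by
  obtain ⟨a, ha⟩ := hD.bound
  obtain ⟨b, hb⟩ := hy.bound
  obtain ⟨c, hc⟩ := hz.bound
  refine IsBigO.of_bound (a * l * (max b c) ^ (l - 1)) ?_
  filter_upwards [ha, hb, hc] with p ha hb hc
  simp only [norm_one, mul_one] at ha hb hc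
  have h := (D p).norm_image_sub_le (fun _ => y p) (fun _ => z p)
  rw [Fintype.card_fin] at h
  refine h.trans ?_
  have e1 : ‖(fun _ : Fin l => y p)‖ ≤ ‖y p‖ := pi_norm_const_le _
  have e2 : ‖(fun _ : Fin l => z p)‖ ≤ ‖z p‖ := pi_norm_const_le _
  have e3 : ‖(fun _ : Fin l => y p) - (fun _ : Fin l => z p)‖ ≤ ‖y p - z p‖ :=
    pi_norm_const_le (y p - z p)
  have e4 : 0 ≤ a := (norm_nonneg _).trans ha
  have e5 : 0 ≤ max b c := ((norm_nonneg _).trans hb).trans (le_max_left _ _)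
  have e6 := e1.trans hb
  have e7 := e2.trans hc
  gcongr

theorem HasExpansion.comp (hγ : 0 < γ) (hW : IsGeometricRoughPath γ T W) {R K k : ℕ}
    (hf : ∀ i, ContDiff ℝ R (f i)) (hKR : K ≤ R) (hKN : K ≤ Nγ γ) (hk : k ≤ K)
    (hB : ∀ t ∈ Set.Icc 0 T, ‖X t‖ ≤ B) (hX : HasExpansion T W f X K id)
    {ψ : E n → ℝ} (hψ : ContDiff ℝ (k + 1 : ℕ) ψ) : HasExpansion T W f X k ψ := by
  have hFc : ∀ v : Word d, v.length ≤ K → Continuous (lieIter f (id : E n → E n) v) := fun v hv =>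
    (contDiff_lieIter (r := 1) hf contDiff_id (by omega)).continuous
  have hFO : ∀ v : Word d, v.length ≤ K →
      (fun p : ℝ × ℝ => lieIter f (id : E n → E n) v (X p.1)) =O[simplexFilter T]
        (fun _ => (1 : ℝ)) := fun v hv => isBigO_one_of_continuous hB (hFc v hv)
  set w : Word d → ℝ × ℝ → ℝ := fun v p => coeff (incr W p.1 p.2) v with hw
  set y : ℝ × ℝ → E n := fun p => X p.2 - X p.1 with hy
  set z : ℝ × ℝ → E n := fun p => ∑ v ∈ (words d k).erase [], w v p • lieIter f id v (X p.1) with hz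
  have hone : ∀ θ : ℝ, 0 ≤ θ → (simplexGauge θ : ℝ × ℝ → ℝ) =O[simplexFilter T] (fun _ => (1 : ℝ)) :=
    fun θ hθ => by rw [one_eq_gauge]; exact gauge_isBigO_gauge hθ
  -- The words of length between `k + 1` and `K` in the expansion of `X` go into the remainder.
  have hyz : (fun p => y p - z p) =O[simplexFilter T] simplexGauge ((k + 1) * γ) := by
    have h1 := hX.trans (gauge_isBigO_gauge
      (show ((k : ℝ) + 1) * γ ≤ (K + 1) * γ by gcongr))
    have h2 : (fun p : ℝ × ℝ => ∑ v ∈ words d K \ words d k, w v p • lieIter f id v (X p.1))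
        =O[simplexFilter T] simplexGauge ((k + 1) * γ) := by
      refine IsBigO.fun_sum fun v hv => ?_
      simp only [Finset.mem_sdiff, mem_words, not_le] at hv
      refine isBigO_incr_smul hW (hv.1.trans hKN) ?_ (hFO v hv.1)
      have : ((k + 1 : ℕ) : ℝ) ≤ v.length := by exact_mod_cast hv.2
      push_cast at this
      gcongr
    refine (h1.add h2).congr' ?_ EventuallyEq.rfl
    filter_upwards [incr_nil_eventually hW] with p hp
    rw [← Finset.sum_sdiff (words_mono hk), ← Finset.add_sum_erase (words d k) _ (a := []) (by simp)]
    simp only [hp, id, hy, hz, hw, one_smul, lieIter]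
    abel
  have hzγ : z =O[simplexFilter T] simplexGauge γ := by
    refine IsBigO.fun_sum fun v hv => ?_
    simp only [mem_erase, mem_words] at hv
    refine isBigO_incr_smul hW (by omega) ?_ (hFO v (by omega))
    have : (1 : ℝ) ≤ v.length := by exact_mod_cast List.length_pos_iff.2 hv.1
    nlinarith
  have hyγ : y =O[simplexFilter T] simplexGauge γ := by
    have := (hyz.trans (gauge_isBigO_gauge (show γ ≤ (k + 1) * γ by nlinarith))).add hzγ
    simpa using this
  have hy1 := hyγ.trans (hone γ hγ.le)
  have hz1 := hzγ.trans (hone γ hγ.le)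
  have hT : (fun p => ψ (X p.2) - ∑ l ∈ range (k + 1), (1 / (l.factorial : ℝ)) *
      iteratedFDeriv ℝ l ψ (X p.1) fun _ => y p) =O[simplexFilter T] simplexGauge ((k + 1) * γ) := by
    obtain ⟨C, hC⟩ := exists_taylor_bound hψ B
    have h1 : (fun p => ψ (X p.2) - ∑ l ∈ range (k + 1), (1 / (l.factorial : ℝ)) *
        iteratedFDeriv ℝ l ψ (X p.1) fun _ => y p) =O[simplexFilter T]
          fun p => ‖y p‖ ^ (k + 1) := by
      refine IsBigO.of_bound C (eventually_simplexFilter.2 fun p h1 h2 h3 => ?_)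
      have := hC (X p.1) (y p) (hB _ ⟨h1, by linarith⟩)
        (by simpa [hy] using hB p.2 ⟨by linarith, h3⟩)
      simp only [hy, add_sub_cancel] at this
      simpa using this
    refine h1.trans ((hyγ.norm_left.pow (k + 1)).trans_eventuallyEq ?_)
    refine eventually_simplexFilter.2 fun p _ h _ => ?_
    simp only [simplexGauge]
    rw [← Real.rpow_natCast, ← Real.rpow_mul (sub_pos.2 h).le]
    push_cast
    rw [mul_comm]
  have hDO : ∀ l ≤ k, (fun p : ℝ × ℝ => iteratedFDeriv ℝ l ψ (X p.1)) =O[simplexFilter T]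
      (fun _ => (1 : ℝ)) := fun l hl => isBigO_one_of_continuous hB
    (hψ.continuous_iteratedFDeriv (by exact_mod_cast (by omega)))
  have hE : (fun p => ∑ l ∈ range (k + 1), (1 / (l.factorial : ℝ)) *
      ((iteratedFDeriv ℝ l ψ (X p.1) fun _ => y p) - iteratedFDeriv ℝ l ψ (X p.1) fun _ => z p))
        =O[simplexFilter T] simplexGauge ((k + 1) * γ) := by
    refine IsBigO.fun_sum fun l hl => IsBigO.const_mul_left ?_ _
    exact (isBigO_multilinear_sub (hDO l (by simpa [Nat.lt_succ_iff] using hl)) hy1 hz1).trans hyz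
  -- This is the error made when, after multilinear expansion in `z`, the products of coefficients
  -- of `W_{st}` are replaced by their shuffle expansions.
  have hP : (fun p => ∑ l ∈ range (k + 1), (1 / (l.factorial : ℝ)) *
      ∑ u ∈ Fintype.piFinset (fun _ : Fin l => (words d k).erase []),
        (∏ r, w (u r) p - ∑ v ∈ words d k, w v p * shufflesEval (wordDelta v) u) *
          iteratedFDeriv ℝ l ψ (X p.1) (fun r => lieIter f id (u r) (X p.1)))
        =O[simplexFilter T] simplexGauge ((k + 1) * γ) := by
    refine IsBigO.fun_sum fun l hl => IsBigO.const_mul_left (IsBigO.fun_sum fun u hu => ?_) _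
    have hu' : ∀ r, (u r).length ≤ k := fun r => by
      have := Fintype.mem_piFinset.1 hu r
      simp at this
      exact this.2
    have hc : (fun p : ℝ × ℝ =>
        iteratedFDeriv ℝ l ψ (X p.1) (fun r => lieIter f id (u r) (X p.1)))
          =O[simplexFilter T] (fun _ => (1 : ℝ)) := by
      refine isBigO_one_of_continuous (g := fun x => iteratedFDeriv ℝ l ψ x
        (fun r => lieIter f id (u r) x)) hB ?_
      have hl' : l ≤ k := by simpa [Nat.lt_succ_iff] using hl
      exact continuous_eval.comp ((hψ.continuous_iteratedFDeriv (m := l)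
        (by exact_mod_cast (by omega))).prodMk
        (continuous_pi fun r => hFc _ ((hu' r).trans hk)))
    simpa using (isBigO_prod_incr_sub hγ hW (hk.trans hKN)
      fun r => (hu' r).trans (hk.trans hKN)).mul hc
  refine ((hT.add hE).add hP).congr_left fun p => ?_
  have hz' : ∀ l, iteratedFDeriv ℝ l ψ (X p.1) (fun _ => z p) =
      ∑ u ∈ Fintype.piFinset (fun _ : Fin l => (words d k).erase []), (∏ r, w (u r) p) *
        iteratedFDeriv ℝ l ψ (X p.1) (fun r => lieIter f id (u r) (X p.1)) := by
    intro l
    simp only [hz]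
    rw [ContinuousMultilinearMap.map_sum_finset]
    refine Finset.sum_congr rfl fun u _ => ?_
    rw [ContinuousMultilinearMap.map_smul_univ, smul_eq_mul]
  have hlie : ∀ v ∈ words d k, lieIter f ψ v (X p.1) = ∑ l ∈ range (k + 1),
      (1 / (l.factorial : ℝ)) * ∑ u ∈ Fintype.piFinset (fun _ : Fin l => (words d k).erase []),
        shufflesEval (wordDelta v) u *
          iteratedFDeriv ℝ l ψ (X p.1) (fun r => lieIter f id (u r) (X p.1)) := by
    intro v hv
    rw [mem_words] at hv
    rw [lieIter_eq_sum_shuffleSum (M := k) (fun u hu =>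
      (contDiff_Fw (r := 1) hf (by omega)).differentiable (by simp)) hv
      (hψ.of_le (by exact_mod_cast (by omega)))]
    -- The sum for `v` stops at `l = |v|`; it is extended by zero terms to a range independent of
    -- `v`, so that the sums can be exchanged.
    rw [Finset.sum_subset (Finset.range_mono (Nat.succ_le_succ hv)) fun l _ hl =>
      shuffleSum_wordDelta_eq_zero (by simpa using hl) _]
    simp only [Fw_eq_lieIter]
    rfl
  simp only [hz', sub_mul, Finset.sum_sub_distrib, mul_sub, smul_eq_mul]
  have hswap : ∑ v ∈ words d k, coeff (incr W p.1 p.2) v * ∑ l ∈ range (k + 1),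
      (1 / (l.factorial : ℝ)) * ∑ u ∈ Fintype.piFinset (fun _ : Fin l => (words d k).erase []),
        shufflesEval (wordDelta v) u *
          iteratedFDeriv ℝ l ψ (X p.1) (fun r => lieIter f id (u r) (X p.1)) =
      ∑ l ∈ range (k + 1), (1 / (l.factorial : ℝ)) *
        ∑ u ∈ Fintype.piFinset (fun _ : Fin l => (words d k).erase []),
          (∑ v ∈ words d k, w v p * shufflesEval (wordDelta v) u) *
            iteratedFDeriv ℝ l ψ (X p.1) (fun r => lieIter f id (u r) (X p.1)) := by
    simp only [Finset.mul_sum, Finset.sum_mul]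
    rw [Finset.sum_comm]
    refine Finset.sum_congr rfl fun l _ => ?_
    rw [Finset.sum_comm]
    refine Finset.sum_congr rfl fun u _ => Finset.sum_congr rfl fun v _ => ?_
    simp only [hw]; ring
  rw [Finset.sum_congr rfl fun v hv => congrArg (coeff (incr W p.1 p.2) v * ·) (hlie v hv), hswap]
  ring

end

section

/-! ### The sewing lemma -/

section Sewing

variable {A : ℝ → ℝ → ℝ} {T C θ : ℝ}

/-- The germ `A` vanishes on the diagonal and is additive up to `C (t - s)^θ`. -/
structure IsAlmostAdditive (A : ℝ → ℝ → ℝ) (T C θ : ℝ) : Prop where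
  diag : ∀ s ∈ Set.Icc 0 T, A s s = 0
  bound : ∀ s u t, 0 ≤ s → s ≤ u → u ≤ t → t ≤ T → |A s t - A s u - A u t| ≤ C * (t - s) ^ θ

/-- Remove the interval that straddles the midpoint. Both remaining blocks have at most half the
length `h`, so by induction they cost `2K(h/2)^θ = 2^{1-θ} K h^θ`, and the two splittings cost `2C
h^θ`. The condition on `K` is exactly that the total is at most `K h^θ`. -/
theorem IsAlmostAdditive.abs_sum_sub_le (hA : IsAlmostAdditive A T C θ) (hC : 0 ≤ C) (hθ : 1 < θ)
    {K : ℝ} (hK : 2 * C ≤ K * (1 - 2 ^ (1 - θ))) (m : ℕ) {p : ℕ → ℝ} (hp : Monotone p)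
    (hpT : ∀ k, p k ∈ Set.Icc 0 T) :
    |∑ k ∈ range m, A (p k) (p (k + 1)) - A (p 0) (p m)| ≤ K * (p m - p 0) ^ θ := by
  have hq : (2 : ℝ) ^ (1 - θ) < 1 := Real.rpow_lt_one_of_one_lt_of_neg (by norm_num) (by linarith)
  have hK0 : 0 ≤ K := by
    by_contra h
    have : K * (1 - 2 ^ (1 - θ)) < 0 := mul_neg_of_neg_of_pos (not_le.1 h) (by linarith)
    linarith
  induction m using Nat.strong_induction_on generalizing p with
  | _ m ih =>
    rcases Nat.eq_zero_or_pos m with rfl | hm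
    · have := Real.rpow_nonneg (le_refl (0 : ℝ)) θ
      simpa [hA.diag _ (hpT 0)] using mul_nonneg hK0 this
    obtain ⟨j, hjm, hj1, hj2⟩ : ∃ j < m, p j ≤ (p 0 + p m) / 2 ∧ (p 0 + p m) / 2 ≤ p (j + 1) := by
      have h0 := hp (Nat.zero_le m)
      have hex : ∃ i, (p 0 + p m) / 2 ≤ p (i + 1) := ⟨m - 1, by
        rw [Nat.sub_add_cancel hm]; linarith⟩
      classical
      refine ⟨Nat.find hex, ?_, ?_, Nat.find_spec hex⟩
      · have := Nat.find_min' hex (m := m - 1) (by rw [Nat.sub_add_cancel hm]; linarith)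
        omega
      · rcases Nat.eq_zero_or_pos (Nat.find hex) with h | h
        · rw [h]; linarith
        · have := Nat.find_min hex (m := Nat.find hex - 1) (by omega)
          rw [Nat.sub_add_cancel h] at this
          exact (not_le.1 this).le
    obtain ⟨l, rfl⟩ : ∃ l, m = j + 1 + l := ⟨m - (j + 1), by omega⟩
    have h1 := ih j (by omega) hp hpT
    have h2 := ih l (by omega) (p := fun k => p (j + 1 + k))
      (fun a b hab => hp (by omega)) (fun k => hpT _)
    have m1 := hp (Nat.zero_le j)
    have m2 := hp (Nat.le_succ j)
    have m3 := hp (Nat.le_add_right (j + 1) l)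
    have d1 := hA.bound (p 0) (p j) (p (j + 1 + l)) (hpT 0).1 m1 (m2.trans m3) (hpT _).2
    have d2 := hA.bound (p j) (p (j + 1)) (p (j + 1 + l)) (hpT j).1 m2 m3 (hpT _).2
    simp only [add_zero] at h2
    set h := p (j + 1 + l) - p 0 with hh
    have hpos : 0 ≤ h := by linarith
    have e1 : (p j - p 0) ^ θ ≤ (h / 2) ^ θ :=
      Real.rpow_le_rpow (by linarith) (by linarith) (by linarith)
    have e2 : (p (j + 1 + l) - p (j + 1)) ^ θ ≤ (h / 2) ^ θ :=
      Real.rpow_le_rpow (by linarith) (by linarith) (by linarith)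
    have e3 : (p (j + 1 + l) - p j) ^ θ ≤ h ^ θ :=
      Real.rpow_le_rpow (by linarith) (by linarith) (by linarith)
    have e4 : 2 * (h / 2) ^ θ = 2 ^ (1 - θ) * h ^ θ := by
      rw [Real.div_rpow hpos (by norm_num), Real.rpow_sub (by norm_num), Real.rpow_one]; ring
    have f1 := mul_le_mul_of_nonneg_left e1 hK0
    have f2 := mul_le_mul_of_nonneg_left e2 hK0
    have f3 := mul_le_mul_of_nonneg_left e3 hC
    have f4 := mul_le_mul_of_nonneg_right hK (Real.rpow_nonneg hpos θ)
    have f5 : K * (2 * (h / 2) ^ θ) = K * (2 ^ (1 - θ) * h ^ θ) := by rw [e4]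
    rw [Finset.sum_range_add, Finset.sum_range_succ]
    simp only [abs_le, ← add_assoc] at h1 h2 d1 d2 ⊢
    clear_value h
    obtain ⟨h1, h1'⟩ := h1
    obtain ⟨h2, h2'⟩ := h2
    obtain ⟨d1, d1'⟩ := d1
    obtain ⟨d2, d2'⟩ := d2
    constructor <;> linarith

/-- A path whose increments are given by the germ up to `K (t - s)^θ`. -/
def IsSewing (A : ℝ → ℝ → ℝ) (T K θ : ℝ) (I : ℝ → ℝ) : Prop :=
  ∀ s t, 0 ≤ s → s < t → t ≤ T → |I t - I s - A s t| ≤ K * (t - s) ^ θ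

-- Riemann sums along uniform grids are bounded by the previous estimate, so they have limits along
-- an ultrafilter and no Cauchy argument is needed. Convergence along arbitrary partitions follows
-- later, from the local estimate on the limit.
open Filter Topology in
theorem IsAlmostAdditive.exists_isSewing (hA : IsAlmostAdditive A T C θ) (hC : 0 ≤ C) (hθ : 1 < θ)
    (hT : 0 < T) : ∃ I K, IsSewing A T K θ I := by
  have hq : (2 : ℝ) ^ (1 - θ) < 1 := Real.rpow_lt_one_of_one_lt_of_neg (by norm_num) (by linarith)
  obtain ⟨K, hK⟩ : ∃ K, 2 * C ≤ K * (1 - 2 ^ (1 - θ)) :=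
    ⟨2 * C / (1 - 2 ^ (1 - θ)), by rw [div_mul_cancel₀ _ (by linarith)]⟩
  set g : ℕ → ℕ → ℝ := fun m k => min (k * (T / (m + 1))) T with hg
  have hg0 : ∀ m, g m 0 = 0 := fun m => by simp [hg, hT.le]
  have hg1 : ∀ m, g m (m + 1) = T := fun m => by
    have : ((m : ℝ) + 1) ≠ 0 := by positivity
    simp only [hg]; push_cast; rw [mul_div_cancel₀ _ this, min_self]
  have hgm : ∀ m, Monotone (g m) := fun m a b hab => by
    have : (a : ℝ) ≤ b := by exact_mod_cast hab
    exact min_le_min_right _ (mul_le_mul_of_nonneg_right this (by positivity))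
  have hgT : ∀ m k, g m k ∈ Set.Icc 0 T := fun m k =>
    ⟨le_min (by positivity) hT.le, min_le_right _ _⟩
  have hgs : ∀ m k, g m (k + 1) - g m k ≤ T / (m + 1) := fun m k => by
    have : ((k + 1 : ℕ) : ℝ) * (T / (m + 1)) = k * (T / (m + 1)) + T / (m + 1) := by
      push_cast; ring
    have hpos : 0 ≤ T / ((m : ℝ) + 1) := by positivity
    simp only [hg, this]
    rcases le_total (k * (T / ((m : ℝ) + 1))) T with h | h
    · rw [min_eq_left h]; linarith [min_le_left (k * (T / ((m : ℝ) + 1)) + T / (m + 1)) T]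
    · rw [min_eq_right h]; linarith [min_le_right (k * (T / ((m : ℝ) + 1)) + T / (m + 1)) T]
  set S : ℕ → ℝ → ℝ := fun m t =>
    ∑ k ∈ range (m + 1), A (min (g m k) t) (min (g m (k + 1)) t) with hS
  have hbdd : ∀ t ∈ Set.Icc 0 T, ∀ m, S m t ∈ Metric.closedBall (A 0 t) (K * t ^ θ) := by
    intro t ht m
    have := hA.abs_sum_sub_le hC hθ hK (m + 1) (p := fun k => min (g m k) t)
      (fun a b hab => min_le_min_right _ (hgm m hab))
      (fun k => ⟨le_min (hgT m k).1 ht.1, (min_le_right _ _).trans ht.2⟩)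
    simp only [hg0, hg1, min_eq_left ht.1, min_eq_right ht.2, sub_zero] at this
    rwa [Metric.mem_closedBall, Real.dist_eq]
  have hlim : ∀ t, ∃ I, t ∈ Set.Icc 0 T → Tendsto (fun m => S m t) (hyperfilter ℕ) (𝓝 I) := by
    intro t
    by_cases ht : t ∈ Set.Icc 0 T
    · obtain ⟨I, -, hI⟩ := (isCompact_closedBall (A 0 t) (K * t ^ θ)).ultrafilter_le_nhds
        ((hyperfilter ℕ).map fun m => S m t) (by
          rw [le_principal_iff]
          exact Filter.mem_map.2 (Filter.univ_mem' (hbdd t ht)))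
      exact ⟨I, fun _ => hI⟩
    · exact ⟨0, fun h => absurd h ht⟩
  choose I hI using hlim
  refine ⟨I, K, fun s t hs hst ht => ?_⟩
  have hsI : s ∈ Set.Icc 0 T := ⟨hs, by linarith⟩
  have htI : t ∈ Set.Icc 0 T := ⟨by linarith, ht⟩
  have hstep : ∀ m, |S m t - S m s - A s t| ≤
      K * (t - s) ^ θ + C * T ^ θ * ((m : ℝ) + 1) ^ (-(θ - 1)) := by
    intro m
    have h1 := hA.abs_sum_sub_le hC hθ hK (m + 1) (p := fun k => max (min (g m k) t) s)
      (fun a b hab => max_le_max_right _ (min_le_min_right _ (hgm m hab)))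
      (fun k => ⟨hs.trans (le_max_right _ _), max_le ((min_le_right _ _).trans ht) hsI.2⟩)
    simp only [hg0, hg1, min_eq_left htI.1, min_eq_right ht, max_eq_right hs, max_eq_left hst.le]
      at h1
    -- Clipping the grid at `s` changes only a cell that contains `s`. The crude count of `m + 1`
    -- cells is affordable: `(m + 1) (T / (m + 1))^θ` tends to `0` as `θ > 1`.
    have h2 : ∀ k ∈ range (m + 1), |A (min (g m k) t) (min (g m (k + 1)) t) -
        A (min (g m k) s) (min (g m (k + 1)) s) -
        A (max (min (g m k) t) s) (max (min (g m (k + 1)) t) s)| ≤ C * (T / (m + 1)) ^ θ := by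
      intro k _
      have hab := hgm m (Nat.le_succ k)
      have hba := hgs m k
      have ha0 := (hgT m k).1
      have hr : 0 ≤ C * (T / ((m : ℝ) + 1)) ^ θ := by positivity
      generalize g m k = a at *
      generalize g m (k + 1) = b at *
      rcases le_total b s with hbs | hsb
      · have has := hab.trans hbs
        rw [min_eq_left (has.trans hst.le), min_eq_left (hbs.trans hst.le), min_eq_left has,
          min_eq_left hbs, max_eq_right has, max_eq_right hbs, hA.diag s hsI]
        simpa using hr
      · rcases le_total s a with hsa | has
        · rw [min_eq_right hsa, min_eq_right hsb, max_eq_left (le_min hsa hst.le),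
            max_eq_left (le_min hsb hst.le), hA.diag s hsI]
          simpa using hr
        · rw [min_eq_left (has.trans hst.le), min_eq_left has, min_eq_right hsb, max_eq_right has,
            max_eq_left (le_min hsb hst.le)]
          refine (hA.bound a s (min b t) ha0 has (le_min hsb hst.le)
            ((min_le_right _ _).trans ht)).trans (mul_le_mul_of_nonneg_left ?_ hC)
          refine Real.rpow_le_rpow ?_ ((sub_le_sub_right (min_le_left _ _) _).trans hba)
            (by linarith)
          exact sub_nonneg.2 (has.trans (le_min hsb hst.le))
    have h3 := (Finset.abs_sum_le_sum_abs _ _).trans (Finset.sum_le_sum h2)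
    rw [Finset.sum_sub_distrib, Finset.sum_sub_distrib, Finset.sum_const, Finset.card_range,
      nsmul_eq_mul] at h3
    have h4 : ((m + 1 : ℕ) : ℝ) * (C * (T / (m + 1)) ^ θ) =
        C * T ^ θ * ((m : ℝ) + 1) ^ (-(θ - 1)) := by
      have hm : (0 : ℝ) < (m : ℝ) + 1 := by positivity
      rw [Real.div_rpow hT.le hm.le, neg_sub, Real.rpow_sub hm, Real.rpow_one]
      push_cast; ring
    rw [h4] at h3
    simp only [hS]
    rw [abs_le] at h1 h3 ⊢
    constructor <;> linarith
  have hl : Tendsto (fun m => |S m t - S m s - A s t|) (hyperfilter ℕ) (𝓝 |I t - I s - A s t|) :=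
    (((hI t htI).sub (hI s hsI)).sub_const _).abs
  have hr : Tendsto (fun m : ℕ => K * (t - s) ^ θ + C * T ^ θ * ((m : ℝ) + 1) ^ (-(θ - 1)))
      (hyperfilter ℕ) (𝓝 (K * (t - s) ^ θ + C * T ^ θ * 0)) := by
    refine Tendsto.mono_left ?_ Nat.hyperfilter_le_atTop
    refine tendsto_const_nhds.add (Tendsto.const_mul _ ?_)
    exact (tendsto_rpow_neg_atTop (by linarith : 0 < θ - 1)).comp
      (tendsto_atTop_add_const_right _ _ tendsto_natCast_atTop_atTop)
  simpa using le_of_tendsto_of_tendsto hl hr (Eventually.of_forall hstep)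

theorem IsPartition.mem_Icc {t δ : ℝ} {m : ℕ} {p : ℕ → ℝ} (hp : IsPartition t δ m p) {k : ℕ}
    (hk : k ≤ m) : p k ∈ Set.Icc 0 t := by
  have key : ∀ a b, a ≤ b → b ≤ m → p a ≤ p b := by
    intro a b hab
    induction hab with
    | refl => exact fun _ => le_rfl
    | step _ ih => exact fun h => (ih (by omega)).trans (hp.lt _ (by omega)).le
  exact ⟨hp.left ▸ key 0 k (Nat.zero_le _) hk, hp.right ▸ key k m hk le_rfl⟩

theorem exists_isPartition {t δ : ℝ} (ht : 0 ≤ t) (hδ : 0 < δ) : ∃ m p, IsPartition t δ m p := by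
  rcases ht.eq_or_lt with rfl | ht
  · exact ⟨0, fun _ => 0, rfl, rfl, by simp, by simp⟩
  · obtain ⟨m, hm⟩ := exists_nat_gt (t / δ)
    have hm0 : (0 : ℝ) < m := (div_pos ht hδ).trans hm
    have hst : ∀ k : ℕ, ((k + 1 : ℕ) : ℝ) * (t / m) - k * (t / m) = t / m := fun k => by
      push_cast; ring
    refine ⟨m, fun k => k * (t / m), by simp, mul_div_cancel₀ _ hm0.ne', fun k _ => ?_,
      fun k _ => ?_⟩
    · have := div_pos ht hm0
      have := hst k
      linarith
    · rw [hst]; exact (div_lt_comm₀ hδ hm0).1 hm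

theorem IsSewing.tendsto {K : ℝ} {I : ℝ → ℝ} (hI : IsSewing A T K θ I) (hθ : 1 < θ) {t : ℝ}
    (ht : t ∈ Set.Icc 0 T) {ε : ℝ} (hε : 0 < ε) : ∃ δ > 0, ∀ (m : ℕ) (p : ℕ → ℝ),
      IsPartition t δ m p → |∑ k ∈ range m, A (p k) (p (k + 1)) - (I t - I 0)| < ε := by
  have hD : 0 < |K| * T + 1 := by have := ht.1.trans ht.2; positivity
  -- Chosen so that `|K| δ^{θ-1} T < ε`: each cell costs at most `|K| δ^{θ-1}` times its length. The
  -- `+ 1` avoids a division by zero.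
  refine ⟨(ε / (|K| * T + 1)) ^ (1 / (θ - 1)), by positivity, fun m p hp => ?_⟩
  set δ := (ε / (|K| * T + 1)) ^ (1 / (θ - 1)) with hδ
  have hδθ : δ ^ (θ - 1) = ε / (|K| * T + 1) := by
    rw [hδ, ← Real.rpow_mul (by positivity), one_div_mul_cancel (by linarith), Real.rpow_one]
  have hterm : ∀ k ∈ range m, |A (p k) (p (k + 1)) - (I (p (k + 1)) - I (p k))| ≤
      |K| * (ε / (|K| * T + 1)) * (p (k + 1) - p k) := by
    intro k hk
    have hk' := Finset.mem_range.1 hk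
    have hlt := hp.lt k hk'
    have h := hI (p k) (p (k + 1)) (hp.mem_Icc hk'.le).1 hlt ((hp.mem_Icc hk').2.trans ht.2)
    rw [abs_sub_comm] at h
    refine h.trans ?_
    have h0 : 0 < p (k + 1) - p k := sub_pos.2 hlt
    have h1 : (p (k + 1) - p k) ^ θ ≤ ε / (|K| * T + 1) * (p (k + 1) - p k) := by
      rw [← hδθ]
      calc (p (k + 1) - p k) ^ θ = (p (k + 1) - p k) ^ (θ - 1) * (p (k + 1) - p k) := by
            conv_lhs => rw [show θ = (θ - 1) + 1 by ring, Real.rpow_add h0, Real.rpow_one]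
        _ ≤ _ := by
            refine mul_le_mul_of_nonneg_right ?_ h0.le
            exact Real.rpow_le_rpow h0.le (hp.mesh k hk').le (by linarith)
    rw [mul_assoc]
    exact (mul_le_mul_of_nonneg_right (le_abs_self K) (Real.rpow_nonneg h0.le _)).trans
      (mul_le_mul_of_nonneg_left h1 (abs_nonneg _))
  have h := (Finset.abs_sum_le_sum_abs _ _).trans (Finset.sum_le_sum hterm)
  rw [Finset.sum_sub_distrib, Finset.sum_range_sub (fun k => I (p k)), ← Finset.mul_sum,
    Finset.sum_range_sub p, hp.left, hp.right, sub_zero] at h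
  refine h.trans_lt ?_
  rw [mul_div_assoc', div_mul_eq_mul_div, div_lt_iff₀ hD]
  nlinarith [mul_le_mul_of_nonneg_left ht.2 (mul_nonneg (abs_nonneg K) hε.le)]

/-- Such an `h` is a sewing of the zero germ, whose Riemann sums all vanish. -/
theorem eq_of_abs_sub_le_rpow {K : ℝ} {h : ℝ → ℝ} (hθ : 1 < θ)
    (hh : ∀ s t, 0 ≤ s → s < t → t ≤ T → |h t - h s| ≤ K * (t - s) ^ θ) {t : ℝ}
    (ht : t ∈ Set.Icc 0 T) : h t = h 0 := by
  have hI : IsSewing (fun _ _ => 0) T K θ h := fun s t h1 h2 h3 => by simpa using hh s t h1 h2 h3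
  by_contra hne
  obtain ⟨δ, hδ, H⟩ := hI.tendsto hθ ht (abs_pos.2 (sub_ne_zero.2 hne))
  obtain ⟨m, p, hp⟩ := exists_isPartition ht.1 hδ
  simpa [abs_sub_comm] using H m p hp

end Sewing

/-! ### Rough integrals -/

variable {d : ℕ} {γ T : ℝ} {W : ℝ → Tens d (Nγ γ)} {i : Fin d} {Y : ℝ → Tens d (Nγ γ - 1)}

theorem IsSewing.isRoughIntegral {K θ : ℝ} {I : ℝ → ℝ} (hI : IsSewing (germ W i Y) T K θ I)
    (hθ : 1 < θ) : IsRoughIntegral T W i Y (fun t => I t - I 0) :=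
  fun _ ht _ hε => hI.tendsto hθ ht hε

theorem IsRoughIntegral.unique {I J : ℝ → ℝ} (hI : IsRoughIntegral T W i Y I)
    (hJ : IsRoughIntegral T W i Y J) {t : ℝ} (ht : t ∈ Set.Icc 0 T) : I t = J t := by
  by_contra hne
  have hpos : 0 < |I t - J t| / 2 := half_pos (abs_pos.2 (sub_ne_zero.2 hne))
  obtain ⟨δ, hδ, H⟩ := hI t ht _ hpos
  obtain ⟨δ', hδ', H'⟩ := hJ t ht _ hpos
  obtain ⟨m, p, hp⟩ := exists_isPartition ht.1 (lt_min hδ hδ')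
  have h1 := H m p ⟨hp.left, hp.right, hp.lt, fun k hk => (hp.mesh k hk).trans_le (min_le_left _ _)⟩
  have h2 := H' m p
    ⟨hp.left, hp.right, hp.lt, fun k hk => (hp.mesh k hk).trans_le (min_le_right _ _)⟩
  have h3 := abs_sub_le (I t) (∑ k ∈ range m, germ W i Y (p k) (p (k + 1))) (J t)
  rw [abs_sub_comm (I t) (∑ k ∈ range m, _)] at h3
  linarith

end

section

open Asymptotics Filter

/-! ### The germ of a controlled path -/

variable {d n : ℕ} {γ T : ℝ} {W : ℝ → Tens d (Nγ γ)}

theorem sum_words_take_drop {M : ℕ} (H : Word d → Word d → ℝ) :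
    ∑ w ∈ words d M, ∑ k ∈ range (w.length + 1), H (w.take k) (w.drop k) =
      ∑ v ∈ words d M, ∑ u ∈ words d (M - v.length), H u v := by
  rw [Finset.sum_sigma', Finset.sum_sigma']
  refine Finset.sum_bij' (fun x _ => ⟨x.1.drop x.2, x.1.take x.2⟩)
    (fun x _ => ⟨x.2 ++ x.1, x.2.length⟩) (fun x hx => ?_) (fun x hx => ?_) (fun x hx => ?_)
    (fun x hx => ?_) fun _ _ => rfl
  · simp only [mem_sigma, mem_words, Finset.mem_range, List.length_drop, List.length_take] at hx ⊢
    omega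
  · simp only [mem_sigma, mem_words, Finset.mem_range, List.length_append] at hx ⊢
    omega
  · simp only [mem_sigma, mem_words, Finset.mem_range] at hx
    refine Sigma.ext (by simp) ?_
    simp; omega
  · simp

theorem pair_conv_dualBasis {N M : ℕ} (g : Tens d N) (Y : Tens d M) {w : Word d}
    (hw : w.length ≤ M) : pair (conv (trunc M g) (dualBasis M w)) Y =
      ∑ v ∈ words d (M - w.length), coeff g v * coeff Y (v ++ w) := by
  have h1 : pair (conv (trunc M g) (dualBasis M w)) Y = ∑ x ∈ words d M,
      ∑ k ∈ range (x.length + 1), (fun u v => coeff g u * (if v = w then 1 else 0) *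
        coeff Y (u ++ v)) (x.take k) (x.drop k) := by
    rw [← sum_tword, pair]
    refine Finset.sum_congr rfl fun x _ => ?_
    rw [conv, Finset.sum_mul]
    refine Finset.sum_congr rfl fun k _ => ?_
    have hx := x.2
    rw [coeff_trunc _ (by simp; omega), coeff_of_le (dualBasis M w) (by simp; omega)]
    simp only [dualBasis, List.take_append_drop]
    rw [coeff_of_le Y hx]
  rw [h1, sum_words_take_drop fun u v => coeff g u * (if v = w then 1 else 0) * coeff Y (u ++ v),
    Finset.sum_eq_single w]
  · simp
  · intro v _ hv
    simp [hv]
  · intro h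
    exact absurd (mem_words.2 hw) h

theorem wconv_append_singleton (g h : Word d → ℝ) (w : Word d) (i : Fin d) :
    wconv g h (w ++ [i]) = ∑ k ∈ range (w.length + 1), g (w.take k) * h (w.drop k ++ [i]) +
      g (w ++ [i]) * h [] := by
  rw [wconv, List.length_append, List.length_singleton, Finset.sum_range_succ]
  congr 1
  · refine Finset.sum_congr rfl fun k hk => ?_
    have hk' : k ≤ w.length := by simpa [Nat.lt_succ_iff] using hk
    rw [List.take_append_of_le_length hk', List.drop_append_of_le_length hk']
  · rw [List.take_of_length_le (by simp), List.drop_of_length_le (by simp)]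

theorem germ_eq_sum_words (i : Fin d) (Y : ℝ → Tens d (Nγ γ - 1)) (a b : ℝ) :
    germ W i Y a b = ∑ w ∈ words d (Nγ γ - 1), coeff (Y a) w * coeff (incr W a b) (w ++ [i]) :=
  sum_tword fun w => coeff (Y a) w * coeff (incr W a b) (w ++ [i])

theorem one_le_Nγ (hγ0 : 0 < γ) (hγ1 : γ < 1) : 1 ≤ Nγ γ :=
  Nat.le_floor (by simpa using (one_le_inv₀ hγ0).2 hγ1.le)

/-- The choice `N = ⌊1/γ⌋` enters here: it puts the sewing exponent above `1`. -/
theorem one_lt_Nγ_add_one_mul (hγ0 : 0 < γ) : 1 < ((Nγ γ : ℝ) + 1) * γ := by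
  have := Nat.lt_floor_add_one γ⁻¹
  rwa [inv_lt_iff_one_lt_mul₀ hγ0] at this

/-- The defect of additivity of the germ. -/
theorem germ_sub_germ_sub_germ (hN : 1 ≤ Nγ γ) (hW : IsGeometricRoughPath γ T W) (i : Fin d)
    (Y : ℝ → Tens d (Nγ γ - 1)) {s u t : ℝ} (hu : u ∈ Set.Icc 0 T) (ht : t ∈ Set.Icc 0 T) :
    germ W i Y s t - germ W i Y s u - germ W i Y u t =
      -∑ v ∈ words d (Nγ γ - 1), (coeff (Y u) v -
        pair (conv (trunc (Nγ γ - 1) (incr W s u)) (dualBasis (Nγ γ - 1) v)) (Y s)) *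
          coeff (incr W u t) (v ++ [i]) := by
  have h1 : germ W i Y s t = germ W i Y s u + ∑ w ∈ words d (Nγ γ - 1),
      ∑ k ∈ range (w.length + 1), (fun x v => coeff (incr W s u) x *
        coeff (incr W u t) (v ++ [i]) * coeff (Y s) (x ++ v)) (w.take k) (w.drop k) := by
    simp only [germ_eq_sum_words]
    rw [← Finset.sum_add_distrib]
    refine Finset.sum_congr rfl fun w hw => ?_
    rw [mem_words] at hw
    -- In Chen's relation at `wi`, the cut after the last letter reproduces the germ on `[s, u]`;
    -- the other cuts `w = xv` assemble the prediction of `Y_u` from `Y_s`.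
    rw [chen (hW.char u hu) (by simp; omega), wconv_append_singleton,
      (hW.isTruncChar_incr hu ht).unit, mul_add, mul_one, Finset.mul_sum, add_comm]
    congr 1
    refine Finset.sum_congr rfl fun k _ => ?_
    simp only [List.take_append_drop]
    ring
  rw [h1, sum_words_take_drop fun x v => coeff (incr W s u) x *
    coeff (incr W u t) (v ++ [i]) * coeff (Y s) (x ++ v), germ_eq_sum_words (a := u), add_sub_cancel_left,
    ← Finset.sum_sub_distrib, ← Finset.sum_neg_distrib]
  refine Finset.sum_congr rfl fun v hv => ?_
  rw [pair_conv_dualBasis _ _ (mem_words.1 hv), sub_mul, Finset.sum_mul]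
  rw [neg_sub]
  congr 1
  exact Finset.sum_congr rfl fun x _ => by ring

theorem coeff_incr_self (hγ : 0 < γ) (hW : IsGeometricRoughPath γ T W) {s : ℝ}
    (hs : s ∈ Set.Icc 0 T) {w : Word d} (hw : w ≠ []) : coeff (incr W s s) w = 0 := by
  rcases le_or_gt w.length (Nγ γ) with h | h
  · obtain ⟨C, -, hC⟩ := hW.exists_bound
    have h1 := hC s hs s hs w h
    have : 0 < w.length := List.length_pos_iff.2 hw
    rw [sub_self, abs_zero, Real.zero_rpow (by positivity), mul_zero] at h1
    exact abs_eq_zero.1 (le_antisymm h1 (abs_nonneg _))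
  · exact coeff_of_lt _ h

theorem IsControlled.exists_isAlmostAdditive (hγ : 0 < γ) (hN : 1 ≤ Nγ γ)
    (hW : IsGeometricRoughPath γ T W) (i : Fin d) {Y : ℝ → Tens d (Nγ γ - 1)}
    (hY : IsControlled γ T W Y) :
    ∃ C, 0 ≤ C ∧ IsAlmostAdditive (germ W i Y) T C (((Nγ γ : ℝ) + 1) * γ) := by
  obtain ⟨C, hC0, hC⟩ := hW.exists_bound
  have hd : ∀ v ∈ words d (Nγ γ - 1), ∃ D, ∀ s t : ℝ, 0 ≤ s → s < t → t ≤ T → |coeff (Y t) v -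
      pair (conv (trunc (Nγ γ - 1) (incr W s t)) (dualBasis (Nγ γ - 1) v)) (Y s)| ≤
        D * (t - s) ^ (((Nγ γ : ℝ) - v.length) * γ) := by
    intro v hv
    have := (hY v (mem_words.1 hv)).2
    rwa [Nat.cast_sub hN, Nat.cast_one, sub_add_cancel] at this
  choose! D hD using hd
  have hdiag : ∀ s ∈ Set.Icc 0 T, germ W i Y s s = 0 := fun s hs => by
    rw [germ_eq_sum_words]
    exact Finset.sum_eq_zero fun w _ => by rw [coeff_incr_self hγ hW hs (by simp), mul_zero]
  refine ⟨∑ v ∈ words d (Nγ γ - 1), |D v| * C, by positivity, hdiag,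
    fun s u t hs hsu hut htT => ?_⟩
  have hr : 0 ≤ (∑ v ∈ words d (Nγ γ - 1), |D v| * C) * (t - s) ^ (((Nγ γ : ℝ) + 1) * γ) :=
    mul_nonneg (by positivity) (Real.rpow_nonneg (by linarith) _)
  have hsI : s ∈ Set.Icc 0 T := ⟨hs, by linarith⟩
  have huI : u ∈ Set.Icc 0 T := ⟨by linarith, by linarith⟩
  have htI : t ∈ Set.Icc 0 T := ⟨by linarith, by linarith⟩
  rcases hsu.eq_or_lt with rfl | hsu
  · simpa [hdiag s hsI] using hr
  rcases hut.eq_or_lt with rfl | hut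
  · simpa [hdiag u huI] using hr
  rw [germ_sub_germ_sub_germ hN hW i Y huI htI, abs_neg, Finset.sum_mul]
  refine (Finset.abs_sum_le_sum_abs _ _).trans (Finset.sum_le_sum fun v hv => ?_)
  have hv' := mem_words.1 hv
  have hst : 0 < t - s := by linarith
  have hvN : (v.length : ℝ) ≤ Nγ γ := by exact_mod_cast (by omega : v.length ≤ Nγ γ)
  have e1 : |coeff (Y u) v -
      pair (conv (trunc (Nγ γ - 1) (incr W s u)) (dualBasis (Nγ γ - 1) v)) (Y s)| ≤
        |D v| * (t - s) ^ (((Nγ γ : ℝ) - v.length) * γ) := by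
    refine (hD v hv s u hs hsu huI.2).trans ?_
    refine mul_le_mul (le_abs_self _) (Real.rpow_le_rpow (by linarith) (by linarith) ?_)
      (Real.rpow_nonneg (by linarith) _) (abs_nonneg _)
    exact mul_nonneg (by linarith) hγ.le
  have e2 : |coeff (incr W u t) (v ++ [i])| ≤ C * (t - s) ^ (((v.length : ℝ) + 1) * γ) := by
    refine (hC u huI t htI _ (by simp; omega)).trans (mul_le_mul_of_nonneg_left ?_ hC0)
    rw [abs_of_pos (by linarith)]
    simp only [List.length_append, List.length_singleton, Nat.cast_add, Nat.cast_one]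
    exact Real.rpow_le_rpow (by linarith) (by linarith) (by positivity)
  rw [abs_mul]
  refine (mul_le_mul e1 e2 (abs_nonneg _) (by positivity)).trans (le_of_eq ?_)
  -- The order of the controlled remainder at `v` and that of the increment at `vi` add up to `(N +
  -- 1)γ`, whatever `v`.
  rw [show ((Nγ γ : ℝ) + 1) * γ = ((Nγ γ : ℝ) - v.length) * γ + ((v.length : ℝ) + 1) * γ by ring,
    Real.rpow_add hst]
  ring

/-- Rough integrals of controlled paths exist. -/
theorem IsControlled.exists_isRoughIntegral (hγ : 0 < γ) (hN : 1 ≤ Nγ γ) (hT : 0 < T)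
    (hW : IsGeometricRoughPath γ T W) (i : Fin d) {Y : ℝ → Tens d (Nγ γ - 1)}
    (hY : IsControlled γ T W Y) : ∃ I, IsRoughIntegral T W i Y I ∧
      (fun p : ℝ × ℝ => I p.2 - I p.1 - germ W i Y p.1 p.2) =O[simplexFilter T]
        simplexGauge (((Nγ γ : ℝ) + 1) * γ) := by
  obtain ⟨C, hC, hA⟩ := hY.exists_isAlmostAdditive hγ hN hW i
  obtain ⟨I, K, hI⟩ := hA.exists_isSewing hC (one_lt_Nγ_add_one_mul hγ) hT
  refine ⟨_, hI.isRoughIntegral (one_lt_Nγ_add_one_mul hγ), isBigO_gauge_iff.2 ⟨K, ?_⟩⟩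
  simpa [IsSewing] using hI

theorem IsRoughIntegral.isBigO (hγ : 0 < γ) (hN : 1 ≤ Nγ γ) (hT : 0 < T)
    (hW : IsGeometricRoughPath γ T W) {i : Fin d} {Y : ℝ → Tens d (Nγ γ - 1)}
    (hY : IsControlled γ T W Y) {J : ℝ → ℝ} (hJ : IsRoughIntegral T W i Y J) :
    (fun p : ℝ × ℝ => J p.2 - J p.1 - germ W i Y p.1 p.2) =O[simplexFilter T]
      simplexGauge (((Nγ γ : ℝ) + 1) * γ) := by
  obtain ⟨I, hI, hO⟩ := hY.exists_isRoughIntegral hγ hN hT hW i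
  refine hO.congr' (eventually_simplexFilter.2 fun p h1 h2 h3 => ?_) EventuallyEq.rfl
  simp only
  rw [hI.unique hJ ⟨h1, by linarith⟩, hI.unique hJ (t := p.2) ⟨by linarith, h3⟩]

theorem sum_words_erase_nil {M : ℕ} (g : Word d → ℝ) :
    ∑ v ∈ (words d (M + 1)).erase [], g v = ∑ i, ∑ w ∈ words d M, g (w ++ [i]) := by
  rw [← Finset.sum_product']
  symm
  refine Finset.sum_bij (fun x _ => x.2 ++ [x.1]) (fun x hx => ?_) (fun x _ y _ h => ?_)
    (fun v hv => ?_) fun _ _ => rfl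
  · simpa using hx
  · have := List.append_inj' h rfl
    exact Prod.ext (by simpa using this.2) this.1
  · rcases List.eq_nil_or_concat v with rfl | ⟨w, i, rfl⟩
    · simp at hv
    · exact ⟨(i, w), by simpa using hv, by simp⟩

end

section

open Asymptotics Filter

/-! ### Paths with values in the solutions of rough differential equations -/

variable {d n : ℕ} {γ T : ℝ} {W : ℝ → Tens d (Nγ γ)} {f : Fin d → E n → E n} {B : ℝ}

/-- Since `Γ_v(Γ_wψ) = Γ_{vw}ψ`, the condition at `w` is the expansion of `Γ_wψ(X)` with `k = M -
|w|`; its expansion with `k = 0` is the Hölder bound. -/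
theorem HasExpansion.isControlled (hγ : 0 < γ) (hW : IsGeometricRoughPath γ T W) {R K M : ℕ}
    {x : ℝ → E n} (hf : ∀ i, ContDiff ℝ R (f i)) (hKR : K ≤ R) (hKN : K ≤ Nγ γ) (hM : M ≤ K)
    (hB : ∀ t ∈ Set.Icc 0 T, ‖x t‖ ≤ B) (hx : HasExpansion T W f x K id)
    {ψ : E n → ℝ} (hψ : ContDiff ℝ (M + 1 : ℕ) ψ) {Y : ℝ → Tens d M}
    (hY : ∀ t ∈ Set.Icc 0 T, ∀ w : Word d, w.length ≤ M →
      coeff (Y t) w = lieIter f ψ w (x t)) : IsControlled γ T W Y := by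
  intro w hw
  have hψw : ContDiff ℝ (M - w.length + 1 : ℕ) (lieIter f ψ w) :=
    contDiff_lieIter hf (hψ.of_le (by exact_mod_cast (by omega))) (by omega)
  constructor
  · have h := hx.comp hγ hW hf hKR hKN (Nat.zero_le K) hB
      (hψw.of_le (by exact_mod_cast (by omega)))
    rw [eqOrder_iff]
    simp only [HasExpansion, Nat.cast_zero, zero_add, one_mul, words_zero, sum_singleton] at h
    refine h.congr' ?_ EventuallyEq.rfl
    filter_upwards [incr_nil_eventually hW, eventually_simplexFilter.2 fun _ h1 h2 h3 =>
      And.intro h1 (And.intro h2 h3)] with p hp hp'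
    rw [hp, one_smul, hY _ ⟨by linarith, hp'.2.2⟩ w hw, hY _ ⟨hp'.1, by linarith⟩ w hw]
    rfl
  · have h := hx.comp hγ hW hf hKR hKN (k := M - w.length) (by omega) hB hψw
    rw [eqOrder_iff]
    rw [HasExpansion, Nat.cast_sub hw] at h
    rw [show (M : ℝ) + 1 - w.length = M - w.length + 1 by ring]
    refine h.congr' ?_ EventuallyEq.rfl
    refine eventually_simplexFilter.2 fun p h1 h2 h3 => ?_
    simp only
    rw [pair_conv_dualBasis _ _ hw, hY _ ⟨by linarith, h3⟩ w hw]
    congr 1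
    refine Finset.sum_congr rfl fun v hv => ?_
    rw [mem_words] at hv
    rw [hY _ ⟨h1, by linarith⟩ _ (by simp; omega), lieIter_append, smul_eq_mul]

theorem hasExpansion_id_of_coord {K : ℕ} {x : ℝ → E n}
    (h : ∀ j, (fun p : ℝ × ℝ => x p.2 j - ∑ v ∈ words d K,
      coeff (incr W p.1 p.2) v * Fw f v (x p.1) j) =O[simplexFilter T] simplexGauge ((K + 1) * γ)) :
    HasExpansion T W f x K id := by
  refine ((EuclideanSpace.equiv (Fin n) ℝ).isBigO_comp_rev _ _).trans (isBigO_pi.2 fun j => ?_)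
  refine (h j).congr_left fun p => ?_
  simp [Fw_eq_lieIter]

theorem coeff_sum_sub {M : ℕ} {ι : Type*} (s : Finset ι) (a b : ι → Tens d M) {w : Word d}
    (hw : w.length ≤ M) :
    coeff (∑ i ∈ s, (a i - b i)) w = ∑ i ∈ s, (coeff (a i) w - coeff (b i) w) := by
  simp [coeff_of_le _ hw]

theorem coeff_sub {M : ℕ} (a b : Tens d M) {w : Word d} (hw : w.length ≤ M) :
    coeff (a - b) w = coeff a w - coeff b w := by
  simp [coeff_of_le _ hw]

theorem coeff_integralLift_nil {M K : ℕ} (i : Fin d) (I : ℝ) (y : Tens d K) :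
    coeff (integralLift M i I y) [] = I := by
  rw [coeff_of_le _ (by simp)]
  simp [integralLift]

theorem coeff_integralLift_append {M K : ℕ} (i i' : Fin d) (I : ℝ) (y : Tens d K) {w : Word d}
    (hw : w.length + 1 ≤ M) :
    coeff (integralLift M i' I y) (w ++ [i]) = if i = i' then coeff y w else 0 := by
  rw [coeff_of_le _ (by simpa using hw)]
  simp [integralLift]

theorem sum_coeff_integralLift_append {M K : ℕ} (I I' : Fin d → ℝ) (y y' : Fin d → Tens d K)
    (i : Fin d) {w : Word d} (hw : w.length + 1 ≤ M) :
    coeff (∑ i, (integralLift M i (I i) (y i) - integralLift M i (I' i) (y' i))) (w ++ [i]) =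
      coeff (y i) w - coeff (y' i) w := by
  rw [coeff_sum_sub _ _ _ (by simpa using hw)]
  simp [coeff_integralLift_append _ _ _ _ hw, Finset.sum_sub_distrib]

theorem vcoeff_vtrunc {N M : ℕ} (X : Fin n → Tens d N) {w : Word d} (hw : w.length ≤ M) :
    vcoeff (vtrunc M X) w = vcoeff X w := by
  unfold vcoeff vtrunc
  congr 1
  exact funext fun j => coeff_trunc _ hw

theorem contDiff_coord {R : ℕ} (hf : ∀ i, ContDiff ℝ R (f i)) (i : Fin d) (j : Fin n) :
    ContDiff ℝ R (fun y => f i y j) :=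
  (EuclideanSpace.proj j : E n →L[ℝ] ℝ).contDiff.comp (hf i)

variable {x₀ : E n} {X : ℝ → Fin n → Tens d (Nγ γ)}

/-- Sorting non-empty words by last letter turns a full expansion into its initial value plus germs.
It serves twice: for `X` with the fields `f_i`, and for `φ(X)` with `Γ_iφ`. -/
theorem germ_sum_eq (hN : 1 ≤ Nγ γ) {ψ : Fin d → E n → ℝ} {Y : Fin d → ℝ → Tens d (Nγ γ - 1)}
    {x : E n} {s t : ℝ}
    (hY : ∀ i, ∀ w : Word d, w.length ≤ Nγ γ - 1 → coeff (Y i s) w = lieIter f (ψ i) w x)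
    {Ψ : Word d → ℝ} (hΨ : ∀ i, ∀ w : Word d, w.length ≤ Nγ γ - 1 →
      Ψ (w ++ [i]) = lieIter f (ψ i) w x) (hnil : coeff (incr W s t) [] = 1) :
    Ψ [] + ∑ i, germ W i (Y i) s t = ∑ v ∈ words d (Nγ γ), coeff (incr W s t) v * Ψ v := by
  rw [← Finset.add_sum_erase (words d (Nγ γ)) _ (a := []) (by simp), hnil, one_mul]
  congr 1
  have : words d (Nγ γ) = words d (Nγ γ - 1 + 1) := by rw [Nat.sub_add_cancel hN]
  rw [this, sum_words_erase_nil]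
  refine Finset.sum_congr rfl fun i _ => ?_
  rw [germ_eq_sum_words]
  refine Finset.sum_congr rfl fun w hw => ?_
  rw [mem_words] at hw
  rw [hY i w hw, hΨ i w hw, mul_comm]

/-! ### Coefficients and local expansion of a solution -/

namespace IsRDESolution

/-- All the coefficients of a solution are functions of its first one. -/
theorem vcoeff_eq (hT : 0 < T) (hf : ∀ i, ContDiff ℝ (Nγ γ + 1 : ℕ) (f i))
    (hX : IsRDESolution T W f x₀ X) {t : ℝ} (ht : t ∈ Set.Icc 0 T) {w : Word d}
    (hw : w.length ≤ Nγ γ) : vcoeff (X t) w = Fw f w (vcoeff (X t) []) := by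
  have h00 : (0 : ℝ) ∈ Set.Icc 0 T := ⟨le_rfl, hT.le⟩
  have h0 : ∀ u : Word d, u.length ≤ Nγ γ → vcoeff (X 0) u = Fw f u x₀ := by
    intro u hu
    ext j
    simp only [vcoeff]
    rw [coeff_of_le _ hu, hX.init]
  induction hl : w.length using Nat.strong_induction_on generalizing w with
  | _ l ih =>
    rcases List.eq_nil_or_concat w with rfl | ⟨v, i, rfl⟩
    · rfl
    rw [List.concat_eq_append] at *
    simp only [List.length_append, List.length_singleton] at hw hl
    obtain ⟨J, -, hJ⟩ := hX.eqn
    ext j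
    -- At `vi` only the lift of `f_i(X)` at `v` enters, and by induction it equals `F_{vi}` at both
    -- times. The initial condition cancels the contribution of time `0`.
    have h1 := congrArg (fun z => coeff z (v ++ [i])) (hJ 0 h00 t ht j)
    rw [sum_coeff_integralLift_append _ _ _ _ _ hw, coeff_sub _ _ (by simpa using hw), fieldLift,
      coeff_compLift (x := vcoeff (X t) []) hf (by omega) (by omega)
        ((contDiff_coord hf i j).of_le (by exact_mod_cast (by omega)))
        (fun u hu => by
          rw [vcoeff_vtrunc _ (by omega)]
          exact ih u.length (by omega) (by omega) rfl),
      fieldLift, coeff_compLift (x := x₀) hf (by omega) (by omega)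
        ((contDiff_coord hf i j).of_le (by exact_mod_cast (by omega)))
        (fun u hu => by rw [vcoeff_vtrunc _ (by omega)]; exact h0 u (by omega)),
      ← Fw_append_singleton hf (by omega), ← Fw_append_singleton hf (by omega)] at h1
    have h2 : coeff (X 0 j) (v ++ [i]) = Fw f (v ++ [i]) x₀ j :=
      congrArg (fun y : E n => y j) (h0 (v ++ [i]) (by simpa using hw))
    rw [h2] at h1
    have : vcoeff (X t) (v ++ [i]) j = coeff (X t j) (v ++ [i]) := rfl
    rw [this]
    linarith

theorem coeff_compLift (hT : 0 < T) (hf : ∀ i, ContDiff ℝ (Nγ γ + 1 : ℕ) (f i))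
    (hX : IsRDESolution T W f x₀ X) {t : ℝ} (ht : t ∈ Set.Icc 0 T) {ψ : E n → ℝ} {w : Word d}
    (hw : w.length ≤ Nγ γ) (hψ : ContDiff ℝ w.length ψ) :
    coeff (compLift ψ (X t)) w = lieIter f ψ w (vcoeff (X t) []) :=
  RoughIto.coeff_compLift hf hw (by omega) hψ fun _ hu => hX.vcoeff_eq hT hf ht (hu.trans hw)

theorem coeff_compLift_vtrunc (hT : 0 < T) (hf : ∀ i, ContDiff ℝ (Nγ γ + 1 : ℕ) (f i))
    (hX : IsRDESolution T W f x₀ X) {t : ℝ} (ht : t ∈ Set.Icc 0 T) {ψ : E n → ℝ} {w : Word d}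
    (hw : w.length ≤ Nγ γ - 1) (hψ : ContDiff ℝ w.length ψ) :
    coeff (compLift ψ (vtrunc (Nγ γ - 1) (X t))) w = lieIter f ψ w (vcoeff (X t) []) :=
  RoughIto.coeff_compLift hf hw (by omega) hψ fun u hu => by
    rw [vcoeff_vtrunc _ (hu.trans hw)]
    exact hX.vcoeff_eq hT hf ht (by omega)

theorem exists_norm_le (hT : 0 < T) (hX : IsRDESolution T W f x₀ X) (hγ : 0 < γ) :
    ∃ B, ∀ t ∈ Set.Icc 0 T, ‖vcoeff (X t) []‖ ≤ B := by
  have h : ∀ j, ∃ b, ∀ t ∈ Set.Icc 0 T, |coeff (X t j) []| ≤ b := by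
    intro j
    obtain ⟨C, hC⟩ := (hX.controlled j [] (by simp)).1
    refine ⟨|coeff (X 0 j) []| + |C| * T ^ γ, fun t ht => ?_⟩
    have hCT : 0 ≤ |C| * T ^ γ := by positivity
    rcases ht.1.eq_or_lt with rfl | h0
    · linarith
    have h1 := hC 0 t le_rfl h0 ht.2
    simp only [vtrunc] at h1
    rw [coeff_trunc _ (by simp), coeff_trunc _ (by simp), sub_zero] at h1
    have h2 : C * t ^ γ ≤ |C| * T ^ γ := mul_le_mul (le_abs_self C)
      (Real.rpow_le_rpow ht.1 ht.2 hγ.le) (by positivity) (abs_nonneg _)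
    have h3 := abs_sub_abs_le_abs_sub (coeff (X t j) []) (coeff (X 0 j) [])
    linarith
  choose b hb using h
  refine ⟨√(∑ j, b j ^ 2), fun t ht => ?_⟩
  rw [EuclideanSpace.norm_eq]
  refine Real.sqrt_le_sqrt (Finset.sum_le_sum fun j _ => ?_)
  exact pow_le_pow_left₀ (norm_nonneg _) (hb j t ht) 2

/-- This is the controlled condition at the empty word, once the coefficients are known to be
`F_v(X_s)`. -/
theorem hasExpansion_pred (hT : 0 < T) (hN : 1 ≤ Nγ γ)
    (hf : ∀ i, ContDiff ℝ (Nγ γ + 1 : ℕ) (f i))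
    (hX : IsRDESolution T W f x₀ X) :
    HasExpansion T W f (fun t => vcoeff (X t) []) (Nγ γ - 1) id := by
  refine hasExpansion_id_of_coord fun j => ?_
  have h := eqOrder_iff.1 (hX.controlled j [] (by simp)).2
  simp only [List.length_nil, Nat.cast_zero, sub_zero] at h
  refine h.congr' (eventually_simplexFilter.2 fun p h1 h2 h3 => ?_) EventuallyEq.rfl
  simp only
  rw [pair_conv_dualBasis _ _ (by simp)]
  simp only [vtrunc, List.append_nil, List.length_nil, Nat.sub_zero]
  rw [coeff_trunc _ (by simp)]
  congr 1
  refine Finset.sum_congr rfl fun v hv => ?_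
  rw [mem_words] at hv
  rw [coeff_trunc _ hv, ← hX.vcoeff_eq hT hf ⟨h1, by linarith⟩ (by omega)]
  rfl

/-- One order is gained through the equation: the expansion of order `Nγ` suffices to control the
integrands, and sewing is accurate to order `(N + 1)γ`. -/
theorem hasExpansion (hT : 0 < T) (hγ : 0 < γ) (hN : 1 ≤ Nγ γ)
    (hf : ∀ i, ContDiff ℝ (Nγ γ + 1 : ℕ) (f i)) (hW : IsGeometricRoughPath γ T W)
    (hX : IsRDESolution T W f x₀ X) :
    HasExpansion T W f (fun t => vcoeff (X t) []) (Nγ γ) id := by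
  obtain ⟨B, hB⟩ := hX.exists_norm_le hT hγ
  have hco : ∀ i j, ∀ t ∈ Set.Icc 0 T, ∀ w : Word d, w.length ≤ Nγ γ - 1 →
      coeff (fieldLift f X i j t) w = lieIter f (fun y => f i y j) w (vcoeff (X t) []) :=
    fun i j t ht w hw => hX.coeff_compLift_vtrunc hT hf ht hw
      ((contDiff_coord hf i j).of_le (by exact_mod_cast (by omega)))
  have hctrl : ∀ i j, IsControlled γ T W (fieldLift f X i j) := fun i j =>
    (hX.hasExpansion_pred hT hN hf).isControlled hγ hW hf (by omega) (by omega) le_rfl hB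
      ((contDiff_coord hf i j).of_le (by exact_mod_cast (by omega))) (hco i j)
  obtain ⟨J, hJ, hXJ⟩ := hX.eqn
  refine hasExpansion_id_of_coord fun j => ?_
  have hsum := IsBigO.fun_sum (s := univ) fun i (_ : i ∈ univ) =>
    (hJ i j).isBigO hγ hN hT hW (hctrl i j)
  refine hsum.congr' ?_ EventuallyEq.rfl
  filter_upwards [incr_nil_eventually hW, eventually_simplexFilter.2 fun _ h1 h2 h3 =>
      And.intro h1 (And.intro h2 h3)] with p hnil hp
  have hs : p.1 ∈ Set.Icc 0 T := ⟨hp.1, by linarith⟩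
  have ht : p.2 ∈ Set.Icc 0 T := ⟨by linarith, hp.2.2⟩
  have h1 := congrArg (fun z => coeff z []) (hXJ p.1 hs p.2 ht j)
  rw [coeff_sum_sub _ _ _ (by simp), coeff_sub _ _ (by simp)] at h1
  simp only [coeff_integralLift_nil] at h1
  rw [← germ_sum_eq (W := W) (s := p.1) (t := p.2) hN (ψ := fun i y => f i y j)
    (Y := fun i => fieldLift f X i j)
    (fun i w hw => hco i j p.1 hs w hw)
    (Ψ := fun v => Fw f v (vcoeff (X p.1) []) j)
    (fun i w hw => Fw_append_singleton hf (by omega) i j _) hnil]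
  rw [Finset.sum_sub_distrib, ← h1]
  change _ = coeff (X p.2 j) [] - (coeff (X p.1 j) [] + _)
  ring

end IsRDESolution

end

end

end RoughIto

/-! ### The Itô formula -/

open RoughIto
theorem mainTheorem5 {d n : ℕ} (γ T : ℝ) (hγ0 : 0 < γ) (hγ1 : γ < 1) (hT : 0 < T)
    (W : ℝ → Tens d (Nγ γ)) (hW : IsGeometricRoughPath γ T W)
    (f : Fin d → E n → E n) (hf : ∀ i, ContDiff ℝ ((Nγ γ + 1 : ℕ) : WithTop ℕ∞) (f i))
    (x : E n) (X : ℝ → Fin n → Tens d (Nγ γ)) (hX : IsRDESolution T W f x X)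
    (φ : E n → ℝ) (hφ : IsCb (Nγ γ + 1) φ) :
    -- the solution and the lifts of the compositions are controlled paths
    (∀ j, IsControlled γ T W (fun t => X t j)) ∧
    IsControlled γ T W (fun t => compLift φ (X t)) ∧
    (∀ i, IsControlled γ T W (gammaLift f φ X i)) ∧
    -- the rough integrals exist
    ∃ I : Fin d → ℝ → ℝ,
      (∀ i, IsRoughIntegral T W i (gammaLift f φ X i) (I i)) ∧
      -- the change of variable formula
      (∀ s ∈ Set.Icc 0 T, ∀ t ∈ Set.Icc 0 T,
        φ (vcoeff (X t) []) = φ (vcoeff (X s) []) + ∑ i, (I i t - I i s)) ∧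
      -- the estimates for the coefficients of the controlled lifts
      (∀ w : Word d, w ≠ [] → w.length ≤ Nγ γ →
        EqOrder T (((Nγ γ : ℝ) + 1 - w.length) * γ)
          (fun _ t => coeff (compLift φ (X t)) w)
          (fun s t => coeff (compLift φ (X s)) w +
            coeff (∑ i, (integralLift (Nγ γ) i (I i t) (gammaLift f φ X i t) -
              integralLift (Nγ γ) i (I i s) (gammaLift f φ X i s))) w)) := by
  have hN : 1 ≤ Nγ γ := one_le_Nγ hγ0 hγ1
  obtain ⟨B, hB⟩ := hX.exists_norm_le hT hγ0
  have hexp := hX.hasExpansion hT hγ0 hN hf hW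
  have hφc : ∀ k ≤ Nγ γ + 1, ContDiff ℝ (k : ℕ) φ := fun k hk =>
    hφ.1.of_le (by exact_mod_cast hk)
  have hΓ : ∀ i, ContDiff ℝ (Nγ γ : ℕ) (Γ f i φ) := fun i =>
    ((hφc _ le_rfl).fderiv_right (by push_cast; rfl)).clm_apply
      ((hf i).of_le (by exact_mod_cast Nat.le_succ _))
  have hcoφ : ∀ t ∈ Set.Icc 0 T, ∀ w : Word d, w.length ≤ Nγ γ →
      coeff (compLift φ (X t)) w = lieIter f φ w (vcoeff (X t) []) :=
    fun t ht w hw => hX.coeff_compLift hT hf ht hw (hφc _ (by omega))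
  have hcoΓ : ∀ i, ∀ t ∈ Set.Icc 0 T, ∀ w : Word d, w.length ≤ Nγ γ - 1 →
      coeff (gammaLift f φ X i t) w = lieIter f (Γ f i φ) w (vcoeff (X t) []) :=
    fun i t ht w hw => hX.coeff_compLift_vtrunc hT hf ht hw
      ((hΓ i).of_le (by exact_mod_cast (by omega)))
  have hctrlΓ : ∀ i, IsControlled γ T W (gammaLift f φ X i) := fun i =>
    hexp.isControlled hγ0 hW hf (by omega) le_rfl (by omega) hB
      ((hΓ i).of_le (by exact_mod_cast (by omega))) (hcoΓ i)
  refine ⟨fun j => ?_, ?_, hctrlΓ, ?_⟩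
  · refine hexp.isControlled hγ0 hW hf (by omega) le_rfl le_rfl hB (ψ := fun y => y j)
      (EuclideanSpace.proj j : E n →L[ℝ] ℝ).contDiff fun t ht w hw => ?_
    rw [lieIter_coord hf (by omega), ← hX.vcoeff_eq hT hf ht hw]
    rfl
  · exact hexp.isControlled hγ0 hW hf (by omega) le_rfl le_rfl hB (hφc _ le_rfl) hcoφ
  choose I hI hIbig using fun i => (hctrlΓ i).exists_isRoughIntegral hγ0 hN hT hW i
  refine ⟨I, hI, ?_, fun w hw0 hw => ?_⟩
  · have hO := (hexp.comp hγ0 hW hf (by omega) le_rfl le_rfl hB (hφc _ le_rfl)).sub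
      (Asymptotics.IsBigO.fun_sum (s := univ) fun i (_ : i ∈ univ) => hIbig i)
    obtain ⟨K, hK⟩ := isBigO_gauge_iff.1 hO
    -- The expansion of `φ(X)` and the local estimates of the integrals share the same germs, so the
    -- increments of this difference are of order `(N + 1)γ > 1`.
    have hconst : ∀ t ∈ Set.Icc 0 T, φ (vcoeff (X t) []) - ∑ i, I i t =
        φ (vcoeff (X 0) []) - ∑ i, I i 0 := fun t ht =>
      eq_of_abs_sub_le_rpow (K := K) (h := fun t => φ (vcoeff (X t) []) - ∑ i, I i t)
        (one_lt_Nγ_add_one_mul hγ0) (fun s t hs hst ht => by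
          have hs' : s ∈ Set.Icc 0 T := ⟨hs, by linarith⟩
          have h := hK s t hs hst ht
          have hg := germ_sum_eq (W := W) (s := s) (t := t) hN
            (ψ := fun i => Γ f i φ) (Y := gammaLift f φ X) (x := vcoeff (X s) [])
            (fun i w hw => hcoΓ i s hs' w hw)
            (Ψ := fun v => lieIter f φ v (vcoeff (X s) []))
            (fun i w _ => congrFun (lieIter_append_singleton f φ w i) _)
            (hW.isTruncChar_incr hs' ⟨by linarith, ht⟩).unit
          simp only [smul_eq_mul, ← hg] at h
          refine le_trans (le_of_eq ?_) h
          rw [Real.norm_eq_abs, Finset.sum_sub_distrib, Finset.sum_sub_distrib]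
          congr 1
          simp only [lieIter]
          ring) ht
    intro s hs t ht
    rw [Finset.sum_sub_distrib]
    linarith [hconst s hs, hconst t ht]
  -- The constant is `0`: at `vi` the lifted integral contributes the increment of `Γ_v(Γ_iφ)(X) =
  -- Γ_{vi}φ(X)`.
  · refine ⟨0, fun s t hs hst ht => ?_⟩
    obtain ⟨v, i, rfl⟩ : ∃ v i, w = v ++ [i] :=
      ⟨_, _, (List.dropLast_append_getLast hw0).symm⟩
    simp only [List.length_append, List.length_singleton] at hw
    have hs' : s ∈ Set.Icc 0 T := ⟨hs, by linarith⟩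
    have ht' : t ∈ Set.Icc 0 T := ⟨by linarith, ht⟩
    beta_reduce
    rw [sum_coeff_integralLift_append (I · t) (I · s) (gammaLift f φ X · t) (gammaLift f φ X · s) i
      hw, hcoφ t ht' _ (by simpa using hw),
      hcoφ s hs' _ (by simpa using hw), hcoΓ i t ht' _ (by omega), hcoΓ i s hs' _ (by omega),
      lieIter_append_singleton]
    simp
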